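/- Let $W$ be a probability space with probability measure $\mathrm{Pr}_W$, let $n_\theta\ge 1$, let $\Theta\subset\mathbb{R}^{n_\theta}$ be convex and closed, let $c\in\mathbb{R}^{n_\theta}$, and let $f:\Theta\times W\to[-\infty,\infty]$ be measurable and such that $f(\cdot,w)$ is convex on $\Theta$ for every $w\in W$. For $\theta\in\Theta$ put $g(\theta,w)=0$ if $f(\theta,w)\le 0$ and $g(\theta,w)=1$ otherwise, and let $E(\theta)=\mathrm{Pr}_W\{g(\theta,w)=1\}$ be the probability of violation. For a multisample $(w^{(1)},\dots,w^{(N)})\in W^N$ consider the scenario program $$\min_{\theta\in\Theta} c^T\theta\quad\text{subject to } g(\theta,w^{(\ell)})=0,\ \ell=1,\dots,N .\tag{1}$$ Assume that for every multisample of size $N$ (of size $n_\theta+1$ in case $N\le n_\theta$) the program (1) is feasible, its feasibility domain has nonempty interior, and it attains a unique optimal solution. Let $\eta,\delta\in(0,1)$. If $$N\ \ge\ \inf_{a>1}\ \frac1\eta\left(\frac{a}{a-1}\right)\left(\ln\frac1\delta+(n_\theta-1)\ln a\right)$$ or $$N\ \ge\ \frac1\eta\left(\ln\frac1\delta+(n_\theta-1)+\sqrt{2(n_\theta-1)\ln\frac1\delta}\,\right),$$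 then, for i.i.d. samples $w^{(1)},\dots,w^{(N)}$ drawn according to $\mathrm{Pr}_W$, with probability no smaller than $1-\delta$ the optimal solution $\hat\theta_N$ of (1) satisfies $E(\hat\theta_N)\le\eta$. -/

import Mathlib

open MeasureTheory Set

noncomputable section

/-- The binary constraint function: `0` if `f θ w ≤ 0` (the design `θ` meets the specification for
the uncertainty `w`), and `1` otherwise. -/
def constraintFn {n : ℕ} {W : Type*} (f : (Fin n → ℝ) → W → EReal) (θ : Fin n → ℝ) (w : W) : ℕ :=
  open Classical in if f θ w ≤ 0 then 0 else 1

/-- Probability of violation `E(θ) = Pr_W {g(θ, w) = 1}`. -/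
def violationProb {n : ℕ} {W : Type*} [MeasurableSpace W] (μ : Measure W)
    (f : (Fin n → ℝ) → W → EReal) (θ : Fin n → ℝ) : ℝ :=
  μ.real {w | constraintFn f θ w = 1}

/-- Feasibility domain of the sampled problem for the multisample `ω = (ω 1, …, ω N)`. -/
def feasibleSet {n : ℕ} {W : Type*} (Θ : Set (Fin n → ℝ)) (f : (Fin n → ℝ) → W → EReal)
    {N : ℕ} (ω : Fin N → W) : Set (Fin n → ℝ) :=
  {θ | θ ∈ Θ ∧ ∀ l, constraintFn f θ (ω l) = 0}

/-- `θ` is an optimal solution of: minimize `cᵀ θ` over `θ ∈ Θ` subject to `g(θ, ω l) = 0` for all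
`l`. -/
def IsScenarioSolution {n : ℕ} {W : Type*} (Θ : Set (Fin n → ℝ)) (c : Fin n → ℝ)
    (f : (Fin n → ℝ) → W → EReal) {N : ℕ} (ω : Fin N → W) (θ : Fin n → ℝ) : Prop :=
  θ ∈ feasibleSet Θ f ω ∧ ∀ θ' ∈ feasibleSet Θ f ω, c ⬝ᵥ θ ≤ c ⬝ᵥ θ'

/-- Convexity: `Θ` is convex and closed, and for every `w` the extended-real-valued function
`f(·, w)` is convex on `Θ`, that is, its epigraph over `Θ` is a convex set. -/
def ConvexityAssumption {n : ℕ} {W : Type*} (Θ : Set (Fin n → ℝ))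
    (f : (Fin n → ℝ) → W → EReal) : Prop :=
  Convex ℝ Θ ∧ IsClosed Θ ∧
    ∀ w, Convex ℝ {p : (Fin n → ℝ) × ℝ | p.1 ∈ Θ ∧ f p.1 w ≤ (p.2 : EReal)}

/-- Feasibility and uniqueness: for every multisample of size `N`, the sampled problem is feasible,
its feasibility domain has nonempty interior, and it attains a unique optimal solution. -/
def FeasibilityUniquenessAssumption {n : ℕ} {W : Type*} (Θ : Set (Fin n → ℝ)) (c : Fin n → ℝ)
    (f : (Fin n → ℝ) → W → EReal) (N : ℕ) : Prop :=
  ∀ ω : Fin N → W,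
    (interior (feasibleSet Θ f ω)).Nonempty ∧ ∃! θ, IsScenarioSolution Θ c f ω θ

end

/-!
The optimal solution of a convex program in `n` variables is determined by at most `n` of its
constraints (Helly's theorem). The core of the argument is the resulting tail bound for the
violation probability `E` of the optimal solution for `N` samples: for every `a > 1`, the
probability of `E > η` is at most `a ^ (n - 1) * (1 - η * (1 - 1 / a)) ^ N`, the Chernoff bound for
fewer than `n` successes in `N` trials of success probability `η`. The sample sizes of the theorem
make this at most `δ`.

The tail bound reduces to a deterministic statement about `N + M` constraints: among all choices of
`N` of them, few have more than `k` violators, that is, constraints violated by the optimal solution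
of the chosen ones (`card_many_violators_convex_le`). Indeed, by exchangeability of the samples this
bounds the probability that the solution for the first `N` samples is violated by more than `η M` of
the other `M`, and if `E > η` then the latter is almost certain for large `M`
(`measureReal_violation_ge_le`).

For constraints in general position the deterministic statement is a double count. Each set of
constraints has a unique basis, which is padded to exactly `n` elements by the first unused
constraints of a fixed enumeration. A set is then recovered from its padded basis and some of the
constraints not violated by it, so that counting the sets of each size gives a triangular linear
system for the numbers of `n`-sets with `s` violators (`IsViolatorSystem.card_viol_eq`). These
numbers are therefore the same as in the model in which an `n`-set is violated by the elements
preceding its last one, where the tail is that of a hypergeometric distribution.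

General position is reached by a perturbation that depends on the finitely many constraints at hand
(`exists_nondegenerate_perturbation`): the constraint sets are shrunk towards a common interior
point by generic factors, and the linear objective is replaced by the distance to a far away point,
which makes minimizers unique. For small perturbations no violation is lost.

Measurability is needed only for optimal values (`measurable_value_image`): by uniqueness of
optimal solutions, a constraint is violated exactly if it raises the optimal value.
-/

/-! ### Violator systems and double counting -/

section ViolatorSystems

open Finset

variable {ι : Type*} [Fintype ι] [DecidableEq ι]

/-- A violator system of dimension `n` on the finite set `ι`: `viol I` is the set of elements
violated by (the solution determined by) the `n`-set `I`, and every set `T` with at least `n`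
elements has exactly one `n`-subset `I` that no element of `T` violates. The values of `viol` at
sets that do not have `n` elements play no role beyond `disjoint_self`. -/
structure IsViolatorSystem (n : ℕ) (viol : Finset ι → Finset ι) : Prop where
  disjoint_self : ∀ I, Disjoint I (viol I)
  existsUnique : ∀ T : Finset ι, n ≤ #T → ∃! I, I ∈ powersetCard n T ∧ Disjoint T (viol I)

namespace IsViolatorSystem

variable {n : ℕ} {viol viol' : Finset ι → Finset ι}

lemma card_viol_le (h : IsViolatorSystem n viol) {I : Finset ι} (hI : #I = n) :
    #(viol I) ≤ Fintype.card ι - n := by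
  have h1 := card_union_of_disjoint (h.disjoint_self I)
  have h2 := card_le_univ (I ∪ viol I)
  omega

lemma card_superset_avoiding (h : IsViolatorSystem n viol) {r : ℕ} (hr : n ≤ r) {I : Finset ι}
    (hI : #I = n) :
    #{T ∈ powersetCard r (univ : Finset ι) | I ⊆ T ∧ Disjoint T (viol I)} =
      (Fintype.card ι - n - #(viol I)).choose (r - n) := by
  have h1 : #(univ \ (I ∪ viol I)) = Fintype.card ι - n - #(viol I) := by
    rw [card_sdiff_of_subset (Finset.subset_univ _), card_union_of_disjoint (h.disjoint_self I), hI,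
      card_univ, Nat.sub_sub]
  rw [← h1, ← card_powersetCard]
  symm
  refine card_bij' (fun U _ => I ∪ U) (fun T _ => T \ I) ?_ ?_ ?_ ?_
  · intro U hU
    simp only [mem_powersetCard] at hU
    have hd : Disjoint I U := by
      rw [Finset.disjoint_left]; intro x hx hx'
      have := hU.1 hx'
      simp [hx] at this
    simp only [Finset.mem_filter, mem_powersetCard, Finset.subset_univ, true_and]
    refine ⟨by rw [card_union_of_disjoint hd]; omega, Finset.subset_union_left, ?_⟩
    rw [Finset.disjoint_union_left]
    refine ⟨h.disjoint_self I, ?_⟩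
    rw [Finset.disjoint_left]; intro x hx hx'
    have := hU.1 hx
    simp [hx'] at this
  · intro T hT
    simp only [Finset.mem_filter, mem_powersetCard, Finset.subset_univ, true_and] at hT
    obtain ⟨h2, h3, h4⟩ := hT
    simp only [mem_powersetCard]
    refine ⟨?_, by rw [card_sdiff_of_subset h3]; omega⟩
    intro x hx
    simp only [Finset.mem_sdiff] at hx
    have := Finset.disjoint_left.1 h4 hx.1
    simp [hx.2, this]
  · intro U hU
    simp only [mem_powersetCard] at hU
    ext x
    simp only [Finset.mem_sdiff, Finset.mem_union]
    constructor
    · tauto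
    · intro hx
      have := hU.1 hx
      simp only [Finset.mem_sdiff, Finset.mem_univ, Finset.mem_union, true_and] at this
      tauto
  · intro T hT
    simp only [Finset.mem_filter] at hT
    exact Finset.union_sdiff_of_subset hT.2.1

/-- The `r`-sets with a prescribed kind of violator count, sorted by the `n`-set that determines
them: there are `(m - n - s).choose (r - n)` ways to extend an `n`-set with `s` violators. -/
lemma card_filter_eq_sum (h : IsViolatorSystem n viol) {r : ℕ} (hr : n ≤ r) (p : ℕ → Prop)
    [DecidablePred p] :
    #{T ∈ powersetCard r (univ : Finset ι) |
        ∃ I ∈ powersetCard n T, Disjoint T (viol I) ∧ p #(viol I)} =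
      ∑ s ∈ range (Fintype.card ι - n + 1), if p s then
        #{I ∈ powersetCard n (univ : Finset ι) | #(viol I) = s} *
          (Fintype.card ι - n - s).choose (r - n) else 0 := by
  have h1 : {T ∈ powersetCard r (univ : Finset ι) |
        ∃ I ∈ powersetCard n T, Disjoint T (viol I) ∧ p #(viol I)} =
      ({I ∈ powersetCard n (univ : Finset ι) | p #(viol I)}).biUnion
        (fun I => {T ∈ powersetCard r (univ : Finset ι) | I ⊆ T ∧ Disjoint T (viol I)}) := by
    ext T
    simp only [Finset.mem_filter, mem_powersetCard, Finset.subset_univ, true_and,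
      Finset.mem_biUnion]
    constructor
    · rintro ⟨h1, I, h2, h3, h4⟩
      exact ⟨I, ⟨h2.2, h4⟩, h1, h2.1, h3⟩
    · rintro ⟨I, ⟨h2, h4⟩, h1, h3, h5⟩
      exact ⟨h1, I, ⟨h3, h2⟩, h5, h4⟩
  rw [h1, card_biUnion]
  · have h2 : ∀ I ∈ ({I ∈ powersetCard n (univ : Finset ι) | p #(viol I)}),
        #{T ∈ powersetCard r (univ : Finset ι) | I ⊆ T ∧ Disjoint T (viol I)} =
          (Fintype.card ι - n - #(viol I)).choose (r - n) := by
      intro I hI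
      simp only [Finset.mem_filter, mem_powersetCard, Finset.subset_univ, true_and] at hI
      exact h.card_superset_avoiding hr hI.1
    rw [sum_congr rfl h2, sum_filter,
      ← sum_fiberwise_of_maps_to (t := range (Fintype.card ι - n + 1)) (g := fun I => #(viol I))]
    · refine sum_congr rfl fun s _ => ?_
      have h3 : ∀ I ∈ ({I ∈ powersetCard n (univ : Finset ι) | #(viol I) = s}),
          (if p #(viol I) then (Fintype.card ι - n - #(viol I)).choose (r - n) else 0) =
          if p s then (Fintype.card ι - n - s).choose (r - n) else 0 := by
        intro I hI
        rw [(Finset.mem_filter.1 hI).2]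
      rw [sum_congr rfl h3, sum_const, smul_eq_mul]
      split_ifs <;> simp
    · intro I hI
      have := h.card_viol_le (mem_powersetCard.1 hI).2
      simp only [Finset.mem_range]; omega
  · intro I hI J hJ hIJ
    rw [Function.onFun, Finset.disjoint_left]
    intro T hT hT'
    simp only [coe_filter, mem_powersetCard, Finset.subset_univ, true_and,
      Set.mem_ofPred_eq] at hI hJ
    simp only [Finset.mem_filter, mem_powersetCard, Finset.subset_univ, true_and] at hT hT'
    refine hIJ ((h.existsUnique T (by omega)).unique ⟨mem_powersetCard.2 ⟨hT.2.1, hI.1⟩, hT.2.2⟩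
      ⟨mem_powersetCard.2 ⟨hT'.2.1, hJ.1⟩, hT'.2.2⟩)

/-- The number of `n`-sets with exactly `s` violators does not depend on the violator system:
every `r`-set has a unique violator-free `n`-subset, so these numbers solve a triangular system of
linear equations, one for each `r`. -/
lemma card_viol_eq (h : IsViolatorSystem n viol) (h' : IsViolatorSystem n viol') {s : ℕ}
    (hs : s ≤ Fintype.card ι - n) :
    #{I ∈ powersetCard n (univ : Finset ι) | #(viol I) = s} =
      #{I ∈ powersetCard n (univ : Finset ι) | #(viol' I) = s} := by
  rcases lt_or_ge (Fintype.card ι) n with hlt | hn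
  · rw [powersetCard_eq_empty.2 (by simpa using hlt)]; simp
  have key : ∀ {v : Finset ι → Finset ι}, IsViolatorSystem n v → ∀ r, n ≤ r →
      (Fintype.card ι).choose r = ∑ s ∈ range (Fintype.card ι - n + 1),
        #{I ∈ powersetCard n (univ : Finset ι) | #(v I) = s} *
          (Fintype.card ι - n - s).choose (r - n) := by
    intro v hv r hr
    have h1 := hv.card_filter_eq_sum hr (fun _ => True)
    simp only [if_true, and_true] at h1
    rw [← h1, filter_true_of_mem, card_powersetCard, card_univ]
    intro T hT
    obtain ⟨I, hI, -⟩ := hv.existsUnique T (by rw [(mem_powersetCard.1 hT).2]; exact hr)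
    exact ⟨I, hI⟩
  induction s using Nat.strong_induction_on with
  | _ s ih =>
    -- In the equation for `r = m - s` the terms beyond `s` vanish and the one at `s` has
    -- factor `1`.
    have h1 := key h (Fintype.card ι - s) (by omega)
    rw [key h' (Fintype.card ι - s) (by omega)] at h1
    have h2 : s ∈ range (Fintype.card ι - n + 1) := by simp; omega
    rw [← add_sum_erase _ _ h2, ← add_sum_erase _ _ h2] at h1
    have h3 : ∑ x ∈ (range (Fintype.card ι - n + 1)).erase s,
        #{I ∈ powersetCard n (univ : Finset ι) | #(viol I) = x} *
          (Fintype.card ι - n - x).choose (Fintype.card ι - s - n) =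
        ∑ x ∈ (range (Fintype.card ι - n + 1)).erase s,
        #{I ∈ powersetCard n (univ : Finset ι) | #(viol' I) = x} *
          (Fintype.card ι - n - x).choose (Fintype.card ι - s - n) := by
      refine sum_congr rfl fun x hx => ?_
      simp only [Finset.mem_erase, Finset.mem_range] at hx
      rcases lt_or_gt_of_ne hx.1 with hlt | hgt
      · rw [ih x hlt (by omega)]
      · rw [Nat.choose_eq_zero_of_lt (by omega), mul_zero, mul_zero]
    have h4 : Fintype.card ι - n - s = Fintype.card ι - s - n := by omega
    rw [h3, h4, Nat.choose_self, mul_one, mul_one] at h1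
    omega

lemma card_filter_eq (h : IsViolatorSystem n viol) (h' : IsViolatorSystem n viol') {r : ℕ}
    (hr : n ≤ r) (p : ℕ → Prop) [DecidablePred p] :
    #{T ∈ powersetCard r (univ : Finset ι) |
        ∃ I ∈ powersetCard n T, Disjoint T (viol I) ∧ p #(viol I)} =
      #{T ∈ powersetCard r (univ : Finset ι) |
        ∃ I ∈ powersetCard n T, Disjoint T (viol' I) ∧ p #(viol' I)} := by
  rw [h.card_filter_eq_sum hr, h'.card_filter_eq_sum hr]
  refine sum_congr rfl fun s hs => ?_
  rw [h.card_viol_eq h' (by simp only [Finset.mem_range] at hs; omega)]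

end IsViolatorSystem

end ViolatorSystems

/-! ### Nondegenerate LP-type problems and the tail of the number of violators -/

section LPType

open Finset

variable {ι : Type*} [Fintype ι] [DecidableEq ι]

/-- A nondegenerate LP-type problem of combinatorial dimension at most `n`. Here `D S` stands for
the optimal value of a minimization problem with constraints labelled by `S`: adding constraints
does not lower it, it stays the same if no single added constraint raises it, it is attained on at
most `n` of the constraints, and no two distinct irredundant sets of constraints have the same
value. -/
structure IsNondegenerateLPType (n : ℕ) (D : Finset ι → ℝ) : Prop where
  mono : ∀ ⦃S T⦄, S ⊆ T → D S ≤ D T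
  locality : ∀ ⦃S T⦄, S ⊆ T → (∀ x ∈ T, D (insert x S) = D S) → D T = D S
  exists_small : ∀ T, ∃ I ⊆ T, #I ≤ n ∧ D I = D T
  nondegenerate : ∀ ⦃I J⦄, (∀ x ∈ I, D (I.erase x) ≠ D I) → (∀ x ∈ J, D (J.erase x) ≠ D J) →
    D I = D J → I = J

/-- The violators of `I` once bases are padded: `B` chooses a basis of each set, the elements of
`I \ B I` count as padding, and an outside element violates `I` if it raises the value or precedes
a padding element in the order given by `rk`. -/
noncomputable def paddedViolators (D : Finset ι → ℝ) (B : Finset ι → Finset ι) (rk : ι → ℕ)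
    (I : Finset ι) : Finset ι :=
  {x | x ∉ I ∧ (D I < D (insert x I) ∨ ∃ y ∈ I \ B I, rk x < rk y)}

lemma exists_initialSegment {α : Type*} [DecidableEq α] (rk : α → ℕ) (U : Finset α) (j : ℕ)
    (hj : j ≤ #U) :
    ∃ A ⊆ U, #A = j ∧ ∀ x ∈ U \ A, ∀ y ∈ A, rk y ≤ rk x := by
  induction j with
  | zero => exact ⟨∅, by simp, by simp, by simp⟩
  | succ j ih =>
    obtain ⟨A, hA, hc, hle⟩ := ih (by omega)
    have hne : (U \ A).Nonempty := by
      rw [← card_pos, card_sdiff_of_subset hA]; omega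
    obtain ⟨z, hz, hmin⟩ := exists_min_image (U \ A) rk hne
    have hz' := Finset.mem_sdiff.1 hz
    refine ⟨insert z A, Finset.insert_subset hz'.1 hA, by rw [card_insert_of_notMem hz'.2, hc], ?_⟩
    intro x hx y hy
    have hx' : x ∈ U \ A := by
      simp only [Finset.mem_sdiff, Finset.mem_insert, not_or] at hx ⊢; exact ⟨hx.1, hx.2.2⟩
    rcases Finset.mem_insert.1 hy with rfl | hy
    · exact hmin x hx'
    · exact hle x hx' y hy

namespace IsNondegenerateLPType

variable {n : ℕ} {D : Finset ι → ℝ}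

omit [Fintype ι] in
lemma exists_basis (h : IsNondegenerateLPType n D) (T : Finset ι) :
    ∃ B ⊆ T, #B ≤ n ∧ D B = D T ∧ ∀ x ∈ B, D (B.erase x) ≠ D B := by
  obtain ⟨I, hIT, hIn, hI⟩ := h.exists_small T
  obtain ⟨B, hB, hmin⟩ := exists_min_image ({B ∈ I.powerset | D B = D I}) card
    ⟨I, by simp⟩
  simp only [Finset.mem_filter, Finset.mem_powerset] at hB hmin
  refine ⟨B, hB.1.trans hIT, (Finset.card_le_card hB.1).trans hIn, hB.2.trans hI, fun x hx he => ?_⟩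
  have h1 := hmin (B.erase x) ⟨(Finset.erase_subset _ _).trans hB.1, he.trans hB.2⟩
  have h2 := card_erase_lt_of_mem hx
  omega

/-- Bases of a nondegenerate problem are unique. Filling them up to exactly `n` elements with the
`rk`-smallest remaining elements keeps them unique and locally recognizable. -/
lemma isViolatorSystem_padded (h : IsNondegenerateLPType n D) {B : Finset ι → Finset ι}
    (hB : ∀ T, B T ⊆ T ∧ #(B T) ≤ n ∧ D (B T) = D T ∧ ∀ x ∈ B T, D ((B T).erase x) ≠ D (B T))
    {rk : ι → ℕ} (hrk : Function.Injective rk) :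
    IsViolatorSystem n (paddedViolators D B rk) where
  disjoint_self I := by
    rw [Finset.disjoint_left]; intro x hx hx'
    exact (Finset.mem_filter.1 hx').2.1 hx
  existsUnique T hT := by
    have hBeq : ∀ {I J}, D I = D J → B I = B J := fun {I J} hIJ =>
      h.nondegenerate (hB I).2.2.2 (hB J).2.2.2 (by rw [(hB I).2.2.1, (hB J).2.2.1, hIJ])
    apply existsUnique_of_exists_of_unique
    · obtain ⟨hBT, hBn, hBD, -⟩ := hB T
      obtain ⟨A, hA, hAc, hle⟩ := exists_initialSegment rk (T \ B T) (n - #(B T))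
        (by rw [card_sdiff_of_subset hBT]; omega)
      have hdisj : Disjoint (B T) A := by
        rw [Finset.disjoint_left]; intro x hx hx'
        exact (Finset.mem_sdiff.1 (hA hx')).2 hx
      have hsub : B T ∪ A ⊆ T := union_subset hBT (hA.trans Finset.sdiff_subset)
      have hD : D (B T ∪ A) = D T :=
        le_antisymm (h.mono hsub) (hBD ▸ h.mono Finset.subset_union_left)
      refine ⟨B T ∪ A, mem_powersetCard.2 ⟨hsub, by
        rw [card_union_of_disjoint hdisj]; omega⟩, ?_⟩
      rw [Finset.disjoint_left]
      intro x hx hxv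
      obtain ⟨hxI, hlt | ⟨y, hy, hxy⟩⟩ := (Finset.mem_filter.1 hxv).2
      · have := h.mono (Finset.insert_subset hx hsub)
        rw [hD] at hlt
        linarith
      · rw [hBeq hD] at hy
        have hyA : y ∈ A := by
          simp only [Finset.mem_sdiff, Finset.mem_union] at hy; tauto
        have hxU : x ∈ (T \ B T) \ A := by
          simp only [Finset.mem_sdiff, Finset.mem_union] at hxI ⊢; tauto
        exact absurd hxy (not_lt.2 (hle x hxU y hyA))
    · rintro I J ⟨hI, hIv⟩ ⟨hJ, hJv⟩
      rw [mem_powersetCard] at hI hJ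
      have hDT : ∀ {I}, I ⊆ T → Disjoint T (paddedViolators D B rk I) → D T = D I := by
        intro I hI hIv
        refine h.locality hI fun x hx => ?_
        by_cases hxI : x ∈ I
        · rw [Finset.insert_eq_of_mem hxI]
        · refine le_antisymm (not_lt.1 fun hlt => ?_) (h.mono (Finset.subset_insert _ _))
          exact Finset.disjoint_left.1 hIv hx
            (Finset.mem_filter.2 ⟨Finset.mem_univ _, hxI, Or.inl hlt⟩)
      have hBIJ : B I = B J := hBeq ((hDT hI.1 hIv).symm.trans (hDT hJ.1 hJv))
      by_contra hne
      have hIJ : ¬ I ⊆ J := fun hs => hne (eq_of_subset_of_card_le hs (by omega))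
      have hJI : ¬ J ⊆ I := fun hs => hne (eq_of_subset_of_card_le hs (by omega)).symm
      obtain ⟨y, hyI, hyJ⟩ := Finset.not_subset.1 hIJ
      obtain ⟨z, hzJ, hzI⟩ := Finset.not_subset.1 hJI
      have h1 : ¬ rk y < rk z := fun hlt => Finset.disjoint_left.1 hJv (hI.1 hyI)
        (Finset.mem_filter.2 ⟨Finset.mem_univ _, hyJ, Or.inr ⟨z,
          Finset.mem_sdiff.2 ⟨hzJ, fun hz => hzI ((hB I).1 (hBIJ ▸ hz))⟩, hlt⟩⟩)
      have h2 : ¬ rk z < rk y := fun hlt => Finset.disjoint_left.1 hIv (hJ.1 hzJ)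
        (Finset.mem_filter.2 ⟨Finset.mem_univ _, hzI, Or.inr ⟨y,
          Finset.mem_sdiff.2 ⟨hyI, fun hy => hyJ ((hB J).1 (hBIJ ▸ hy))⟩, hlt⟩⟩)
      exact hyJ (hrk (by omega : rk y = rk z) ▸ hzJ)

omit [Fintype ι] in
/-- The problem without effective constraints. Its padded violator system serves as a model: an
`n`-set is violated by the elements preceding its last one. -/
lemma const : IsNondegenerateLPType n (fun _ : Finset ι => (0 : ℝ)) where
  mono _ _ _ := le_rfl
  locality _ _ _ _ := rfl
  exists_small T := ⟨∅, by simp, by simp, rfl⟩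
  nondegenerate I J hI hJ _ := by
    have h1 : ∀ {I : Finset ι}, (∀ x ∈ I, (0 : ℝ) ≠ 0) → I = ∅ := fun {I} hI =>
      eq_empty_of_forall_notMem fun x hx => hI x hx rfl
    rw [h1 hI, h1 hJ]

end IsNondegenerateLPType

/-- The bound `N! e_N(g) ≤ e_1(g) ^ N` for elementary symmetric sums of nonnegative numbers. -/
lemma factorial_mul_esymm_le {α : Type*} [DecidableEq α] (s : Finset α) (g : α → ℝ)
    (hg : ∀ i, 0 ≤ g i) (N : ℕ) :
    (N.factorial : ℝ) * ∑ S ∈ powersetCard N s, ∏ i ∈ S, g i ≤ (∑ i ∈ s, g i) ^ N := by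
  induction s using Finset.induction_on generalizing N with
  | empty =>
    cases N with
    | zero => simp
    | succ N => rw [powersetCard_eq_empty.2 (by simp)]; simp
  | insert a s ha ih =>
    cases N with
    | zero => simp
    | succ N =>
      have hs : 0 ≤ ∑ i ∈ s, g i := sum_nonneg fun i _ => hg i
      rw [powersetCard_succ_insert ha, sum_union, sum_image, sum_insert ha]
      · have h1 : ∑ S ∈ powersetCard N s, ∏ i ∈ insert a S, g i =
            g a * ∑ S ∈ powersetCard N s, ∏ i ∈ S, g i := by
          rw [mul_sum]
          refine sum_congr rfl fun S hS => prod_insert fun h => ha ((mem_powersetCard.1 hS).1 h)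
        rw [h1]
        have h2 := ih (N + 1)
        have h3 := mul_le_mul_of_nonneg_left (ih N) (mul_nonneg (Nat.cast_nonneg (N + 1)) (hg a))
        have h4 : (∑ i ∈ s, g i) ^ (N + 1) + (N + 1 : ℕ) * g a * (∑ i ∈ s, g i) ^ N ≤
            (g a + ∑ i ∈ s, g i) ^ (N + 1) := by
          rw [add_comm (g a), add_pow, sum_range_succ, sum_range_succ]
          have : 0 ≤ ∑ x ∈ Finset.range N, (∑ i ∈ s, g i) ^ x * g a ^ (N + 1 - x) *
              ((N + 1).choose x : ℝ) :=
            sum_nonneg fun x _ => by have := hg a; positivity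
          simp
          nlinarith
        rw [Nat.factorial_succ] at h2 ⊢
        push_cast at *
        nlinarith
      · intro S hS T hT hST
        have h1 : a ∉ S := fun h => ha ((mem_powersetCard.1 hS).1 h)
        have h2 : a ∉ T := fun h => ha ((mem_powersetCard.1 hT).1 h)
        rw [← erase_insert h1, hST, erase_insert h2]
      · rw [Finset.disjoint_left]
        intro S hS hS'
        obtain ⟨T, -, rfl⟩ := Finset.mem_image.1 hS'
        exact ha ((mem_powersetCard.1 hS).1 (Finset.mem_insert_self _ _))

/-- Chernoff bound for the hypergeometric distribution: few `N`-sets meet `F` in at most `d`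
elements. -/
lemma card_few_hits_le (F : Finset ι) (d N : ℕ) {a : ℝ} (ha : 1 ≤ a) :
    (#{S ∈ powersetCard N (univ : Finset ι) | #(S ∩ F) ≤ d} : ℝ) * N.factorial ≤
      a ^ d * (Fintype.card ι - #F * (1 - 1 / a)) ^ N := by
  have ha0 : 0 < a := by linarith
  let g : ι → ℝ := fun i => if i ∈ F then 1 / a else 1
  have hg : ∀ i, 0 ≤ g i := fun i => by simp only [g]; split_ifs <;> positivity
  have hsum : ∑ i, g i = Fintype.card ι - #F * (1 - 1 / a) := by
    have h1 : ∀ i, g i = 1 - if i ∈ F then (1 - 1 / a) else 0 := fun i => by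
      simp only [g]; split_ifs <;> ring
    simp only [h1, sum_sub_distrib, sum_ite_mem, Finset.univ_inter, sum_const, nsmul_eq_mul,
      mul_one, card_univ]
    ring
  have hprod : ∀ S : Finset ι, ∏ i ∈ S, g i = (1 / a) ^ #(S ∩ F) := fun S => by
    simp only [g]
    rw [prod_ite, prod_const, prod_const_one, mul_one, filter_mem_eq_inter]
  have h2 := factorial_mul_esymm_le univ g hg N
  rw [hsum] at h2
  -- Each set counted has weight `a ^ d * (1 / a) ^ #(S ∩ F) ≥ 1`.
  have h3 : (#{S ∈ powersetCard N (univ : Finset ι) | #(S ∩ F) ≤ d} : ℝ) ≤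
      a ^ d * ∑ S ∈ powersetCard N (univ : Finset ι), ∏ i ∈ S, g i := by
    rw [mul_sum, card_eq_sum_ones, Nat.cast_sum]
    refine (sum_le_sum fun S hS => ?_).trans (sum_le_sum_of_subset_of_nonneg (filter_subset _ _)
      fun S _ _ => mul_nonneg (by positivity) (prod_nonneg fun i _ => hg i))
    rw [hprod, Nat.cast_one, one_div, inv_pow, ← div_eq_mul_inv, le_div_iff₀ (by positivity),
      one_mul]
    exact pow_le_pow_right₀ ha (Finset.mem_filter.1 hS).2
  calc _ ≤ (a ^ d * ∑ S ∈ powersetCard N (univ : Finset ι), ∏ i ∈ S, g i) * N.factorial := by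
        gcongr
    _ = a ^ d * (N.factorial * ∑ S ∈ powersetCard N (univ : Finset ι), ∏ i ∈ S, g i) := by ring
    _ ≤ _ := by gcongr

/-- Few `N`-sets have more than `k` violators. By double counting, the number of these sets is at
most what it is in the model where an `n`-set is violated by the elements preceding its last one;
there, such an `N`-set meets the first `n + k` elements in fewer than `n` points. -/
theorem IsNondegenerateLPType.card_many_violators_le {n : ℕ} {D : Finset ι → ℝ}
    (h : IsNondegenerateLPType n D) {N k : ℕ} (hn : 1 ≤ n) (hN : n ≤ N)
    (hk : n + k ≤ Fintype.card ι) {a : ℝ} (ha : 1 ≤ a) :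
    (#{S ∈ powersetCard N (univ : Finset ι) | k < #{x ∈ Sᶜ | D S < D (insert x S)}} : ℝ) *
      N.factorial ≤ a ^ (n - 1) * (Fintype.card ι - (n + k : ℕ) * (1 - 1 / a)) ^ N := by
  choose B hB using h.exists_basis
  let rk : ι → ℕ := fun i => Fintype.equivFin ι i
  have hrk : Function.Injective rk := fun x y hxy =>
    (Fintype.equivFin ι).injective (Fin.ext hxy)
  have hV := h.isViolatorSystem_padded hB hrk
  have hV' := (IsNondegenerateLPType.const (ι := ι) (n := n)).isViolatorSystem_padded
    (B := fun _ => ∅) (by simp) hrk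
  let F : Finset ι := {i | rk i < n + k}
  have hF : ∀ j ≤ Fintype.card ι, #({i | rk i < j} : Finset ι) = j := by
    intro j hj
    have : ({i | rk i < j} : Finset ι).map
        ((Fintype.equivFin ι).toEmbedding.trans Fin.valEmbedding) = Finset.range j := by
      ext l
      simp only [Finset.mem_map, Finset.mem_filter, Finset.mem_univ, true_and, Finset.mem_range, rk]
      constructor
      · rintro ⟨i, hi, rfl⟩; exact hi
      · intro hl
        exact ⟨(Fintype.equivFin ι).symm ⟨l, by omega⟩, by simpa using hl, by simp⟩
    rw [← card_map, this, card_range]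
  refine le_trans ?_ ((card_few_hits_le F (n - 1) N ha).trans_eq (by rw [hF _ hk]))
  gcongr ?_ * _
  rw [Nat.cast_le]
  calc _ ≤ #{T ∈ powersetCard N (univ : Finset ι) | ∃ I ∈ powersetCard n T,
          Disjoint T (paddedViolators D B rk I) ∧ k < #(paddedViolators D B rk I)} := by
        refine Finset.card_le_card fun S hS => ?_
        obtain ⟨hSN, hkS⟩ := Finset.mem_filter.1 hS
        have hSc := (mem_powersetCard.1 hSN).2
        obtain ⟨I, ⟨hI, hdisj⟩, -⟩ := hV.existsUnique S (by omega)
        refine Finset.mem_filter.2 ⟨hSN, I, hI, hdisj,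
          hkS.trans_le (Finset.card_le_card fun x hx => ?_)⟩
        have hIS := (mem_powersetCard.1 hI).1
        obtain ⟨hxS, hlt⟩ := Finset.mem_filter.1 hx
        have hxS' : x ∉ S := by simpa using hxS
        refine Finset.mem_filter.2 ⟨Finset.mem_univ _, fun hxI => hxS' (hIS hxI), Or.inl ?_⟩
        by_contra hcon
        have hloc : ∀ y ∈ insert x S, D (insert y I) = D I := by
          intro y hy
          refine le_antisymm (not_lt.1 fun hlt' => ?_) (h.mono (Finset.subset_insert _ _))
          rcases Finset.mem_insert.1 hy with rfl | hyS
          · exact hcon hlt'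
          · by_cases hyI : y ∈ I
            · rw [Finset.insert_eq_of_mem hyI] at hlt'; exact lt_irrefl _ hlt'
            · exact Finset.disjoint_left.1 hdisj hyS
                (Finset.mem_filter.2 ⟨Finset.mem_univ _, hyI, Or.inl hlt'⟩)
        have h1 := h.locality (hIS.trans (Finset.subset_insert x S)) hloc
        have h2 := h.mono hIS
        linarith
    _ = #{T ∈ powersetCard N (univ : Finset ι) | ∃ I ∈ powersetCard n T,
          Disjoint T (paddedViolators (fun _ => 0) (fun _ => ∅) rk I) ∧
            k < #(paddedViolators (fun _ => 0) (fun _ => ∅) rk I)} :=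
        hV.card_filter_eq hV' hN (fun s => k < s)
    _ ≤ _ := by
        refine Finset.card_le_card fun S hS => ?_
        obtain ⟨hSN, I, hI, hdisj, hkI⟩ := Finset.mem_filter.1 hS
        refine Finset.mem_filter.2 ⟨hSN, ?_⟩
        obtain ⟨hIS, hIn⟩ := mem_powersetCard.1 hI
        obtain ⟨y, hyI, hmax⟩ := exists_max_image I rk (card_pos.1 (by omega))
        have hsub : I ∪ paddedViolators (fun _ => 0) (fun _ => ∅) rk I ⊆
            ({i | rk i < rk y + 1} : Finset ι) := by
          intro x hx
          refine Finset.mem_filter.2 ⟨Finset.mem_univ _, ?_⟩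
          rcases Finset.mem_union.1 hx with hx | hx
          · have := hmax x hx; omega
          · obtain ⟨-, hlt | ⟨z, hz, hxz⟩⟩ := (Finset.mem_filter.1 hx).2
            · exact absurd hlt (lt_irrefl _)
            · have := hmax z (Finset.mem_sdiff.1 hz).1; omega
        have hcard := Finset.card_le_card hsub
        rw [card_union_of_disjoint (hV'.disjoint_self I), hIn,
          hF _ (by have := ((Fintype.equivFin ι) y).isLt; simp only [rk]; omega)] at hcard
        have hSF : S ∩ F ⊆ I.erase y := by
          intro x hx
          obtain ⟨hxS, hxF⟩ := Finset.mem_inter.1 hx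
          have hxF' : rk x < n + k := (Finset.mem_filter.1 hxF).2
          refine Finset.mem_erase.2 ⟨fun hxy => by subst hxy; omega, ?_⟩
          by_contra hxI
          exact Finset.disjoint_left.1 hdisj hxS (Finset.mem_filter.2 ⟨Finset.mem_univ _, hxI,
            Or.inr ⟨y, by simpa using hyI, by omega⟩⟩)
        have := Finset.card_le_card hSF
        rw [card_erase_of_mem hyI] at this
        omega

end LPType

/-! ### Perturbing convex constraints into general position -/

section Perturbation

open Finset Metric Module
open scoped Pointwise RealInnerProductSpace

section Helly

variable {E ι : Type*} [AddCommGroup E] [Module ℝ E] [FiniteDimensional ℝ E]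

/-- Helly's theorem with a distinguished convex set `L`. With `L` a sublevel set of the objective it
shows that an optimal value is attained on at most `finrank ℝ E` of the constraints. -/
lemma helly_inter_nonempty {F : ι → Set E} {s : Finset ι} {L : Set E}
    (hF : ∀ i ∈ s, Convex ℝ (F i)) (hL : Convex ℝ L)
    (h1 : ∀ I ⊆ s, #I ≤ finrank ℝ E + 1 → (⋂ i ∈ I, F i).Nonempty)
    (h2 : ∀ I ⊆ s, #I ≤ finrank ℝ E → (L ∩ ⋂ i ∈ I, F i).Nonempty) :
    (L ∩ ⋂ i ∈ s, F i).Nonempty := by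
  classical
  let G : Option ι → Set E := fun o => o.elim L F
  have key : (⋂ o ∈ insertNone s, G o).Nonempty := by
    refine Convex.helly_theorem' (𝕜 := ℝ) ?_ ?_
    · intro o ho
      cases o with
      | none => exact hL
      | some i => exact hF i (by simpa using ho)
    · intro I hI hc
      have hsub : eraseNone I ⊆ s := fun i hi => by
        simpa using hI (mem_eraseNone.1 hi)
      by_cases hn : none ∈ I
      · obtain ⟨y, hyL, hy⟩ := h2 (eraseNone I) hsub (by
          rw [card_eraseNone_of_mem hn]
          omega)
        refine ⟨y, Set.mem_iInter₂.2 fun o ho => ?_⟩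
        cases o with
        | none => exact hyL
        | some i => exact Set.mem_iInter₂.1 hy i (mem_eraseNone.2 ho)
      · obtain ⟨y, hy⟩ := h1 (eraseNone I) hsub ((card_eraseNone_le _).trans hc)
        refine ⟨y, Set.mem_iInter₂.2 fun o ho => ?_⟩
        cases o with
        | none => exact absurd ho hn
        | some i => exact Set.mem_iInter₂.1 hy i (mem_eraseNone.2 ho)
  obtain ⟨y, hy⟩ := key
  rw [Set.mem_iInter₂] at hy
  exact ⟨y, hy none (by simp), Set.mem_iInter₂.2 fun i hi => hy (some i) (by simpa using hi)⟩

end Helly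

/-- Finitely many sets, each meeting every line parallel to one coordinate axis in at most one
point, cannot cover a product grid `A ^ ι` with `A` infinite: in a subgrid of side
`card β + 1` each of them has at most `(card β + 1) ^ (card ι - 1)` points. -/
lemma exists_generic {ι β : Type*} [Fintype ι] [Finite β] (bad : β → Set (ι → ℝ)) (x : β → ι)
    {A : Set ℝ} (hA : A.Infinite)
    (h : ∀ b, ∀ r ∈ bad b, ∀ r' ∈ bad b, (∀ i, r i ∈ A) → (∀ i, r' i ∈ A) →
      (∀ i ≠ x b, r i = r' i) → r = r') :
    ∃ r : ι → ℝ, (∀ i, r i ∈ A) ∧ ∀ b, r ∉ bad b := by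
  classical
  cases nonempty_fintype β
  by_contra! hcon
  obtain ⟨A', hA', hcard⟩ := hA.exists_subset_card_eq (Fintype.card β + 1)
  let G : Finset (ι → ℝ) := Fintype.piFinset fun _ => A'
  have hGA : ∀ r ∈ G, ∀ i, r i ∈ A := fun r hr i => hA' (by simpa using Fintype.mem_piFinset.1 hr i)
  have hG : #G = (Fintype.card β + 1) ^ Fintype.card ι := by
    simp [G, Fintype.card_piFinset, hcard]
  have hb : ∀ b, #{r ∈ G | r ∈ bad b} ≤ (Fintype.card β + 1) ^ (Fintype.card ι - 1) := by
    intro b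
    let G' : Finset ({i // i ≠ x b} → ℝ) := Fintype.piFinset fun _ => A'
    have hG' : #G' = (Fintype.card β + 1) ^ (Fintype.card ι - 1) := by
      simp [G', Fintype.card_piFinset, hcard]
    rw [← hG']
    refine card_le_card_of_injOn (fun r i => r i) ?_ ?_
    · intro r hr
      simp only [coe_filter, Set.mem_ofPred_eq] at hr
      refine mem_coe.2 (Fintype.mem_piFinset.2 fun i => Fintype.mem_piFinset.1 hr.1 i)
    · intro r hr r' hr' hrr
      simp only [coe_filter, Set.mem_ofPred_eq] at hr hr'
      exact h b r hr.2 r' hr'.2 (hGA r hr.1) (hGA r' hr'.1) fun i hi => congrFun hrr ⟨i, hi⟩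
  have hsub : G ⊆ Finset.univ.biUnion fun b => {r ∈ G | r ∈ bad b} := by
    intro r hr
    obtain ⟨b, hb⟩ := hcon r (hGA r hr)
    exact Finset.mem_biUnion.2 ⟨b, Finset.mem_univ _, Finset.mem_filter.2 ⟨hr, hb⟩⟩
  have h1 := (Finset.card_le_card hsub).trans (card_biUnion_le.trans (sum_le_sum fun b _ => hb b))
  rw [hG, sum_const, card_univ, smul_eq_mul] at h1
  rcases isEmpty_or_nonempty β with hβ | ⟨⟨b⟩⟩
  · rw [Fintype.card_eq_zero, zero_mul, zero_add, one_pow] at h1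
    omega
  · have h2 : Fintype.card ι = Fintype.card ι - 1 + 1 := by
      have := Fintype.card_pos_iff.2 ⟨x b⟩
      omega
    rw [h2, pow_succ, Nat.add_sub_cancel, mul_comm] at h1
    have := Nat.le_of_mul_le_mul_right h1 (by positivity)
    omega

variable {E ι : Type*} [NormedAddCommGroup E] [InnerProductSpace ℝ E] [FiniteDimensional ℝ E]

omit [FiniteDimensional ℝ E] in
lemma eq_of_dist_eq_infDist {K : Set E} (hK : Convex ℝ K) {z y u : E} (hy : y ∈ K) (hu : u ∈ K)
    (hyd : dist z y = infDist z K) (hud : dist z u = infDist z K) : y = u := by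
  by_contra hne
  have h1 := combo_mem_ball_of_ne (z := z) (r := infDist z K) (x := y) (y := u)
    (a := 1 / 2) (b := 1 / 2) (by rw [mem_closedBall', hyd]) (by rw [mem_closedBall', hud]) hne
    (by norm_num) (by norm_num) (by norm_num)
  rw [mem_ball'] at h1
  exact absurd (infDist_le_dist_of_mem (hK hy hu (by norm_num) (by norm_num) (by norm_num)))
    (not_le.2 h1)

omit [FiniteDimensional ℝ E] in
lemma smul_closure_subset_interior {C : Set E} (hC : Convex ℝ C) (h0 : (0 : E) ∈ interior C)
    {r r' : ℝ} (hr : 0 < r) (hrr : r < r') :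
    r • closure C ⊆ interior (r' • closure C) := by
  have hr' : 0 < r' := hr.trans hrr
  rintro _ ⟨y, hy, rfl⟩
  rw [interior_smul₀ hr'.ne']
  refine ⟨(r / r') • y, ?_, by simp only [smul_smul]; congr 1; field_simp⟩
  have h1 := hC.combo_interior_closure_mem_interior h0 hy (a := 1 - r / r') (b := r / r')
    (by rw [sub_pos, div_lt_one hr']; exact hrr) (by positivity) (by ring)
  rw [smul_zero, zero_add] at h1
  exact interior_mono subset_closure h1

omit [FiniteDimensional ℝ E] in
lemma smul_closure_subset_self {C : Set E} (hC : Convex ℝ C) (h0 : (0 : E) ∈ interior C)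
    {r : ℝ} (hr : 0 < r) (hr1 : r < 1) : r • closure C ⊆ C := by
  have h1 := smul_closure_subset_interior hC h0 hr hr1
  rw [one_smul, hC.interior_closure_eq_interior_of_nonempty_interior ⟨0, h0⟩] at h1
  exact h1.trans interior_subset

variable [DecidableEq ι]

/-- The distance from `z` to the intersection of the closed constraint sets labelled by `S`, each
shrunk towards `0` by its own factor `r i`. For `z` far away in the direction of descent, it
replaces the optimal value of a linear program by that of a strictly convex one. -/
noncomputable def scaledDist (C : ι → Set E) (z : E) (r : ι → ℝ) (S : Finset ι) : ℝ :=
  infDist z (⋂ i ∈ S, r i • closure (C i))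

section

variable {C : ι → Set E} {z : E} {r : ι → ℝ}

omit [FiniteDimensional ℝ E] [DecidableEq ι] in
lemma convex_inter_scaled (hC : ∀ i, Convex ℝ (C i)) (S : Finset ι) :
    Convex ℝ (⋂ i ∈ S, r i • closure (C i)) :=
  convex_iInter₂ fun i _ => (hC i).closure.smul _

omit [FiniteDimensional ℝ E] [DecidableEq ι] in
lemma zero_mem_inter_scaled (h0 : ∀ i, (0 : E) ∈ interior (C i)) (S : Finset ι) :
    (0 : E) ∈ ⋂ i ∈ S, r i • closure (C i) :=
  Set.mem_iInter₂.2 fun i _ => ⟨0, subset_closure (interior_subset (h0 i)), smul_zero _⟩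

omit [DecidableEq ι] in
lemma exists_dist_eq_scaledDist (h0 : ∀ i, (0 : E) ∈ interior (C i))
    (hr : ∀ i, 0 < r i) (S : Finset ι) :
    ∃ y ∈ ⋂ i ∈ S, r i • closure (C i), dist z y = scaledDist C z r S := by
  have hcl : IsClosed (⋂ i ∈ S, r i • closure (C i)) :=
    isClosed_biInter fun i _ => isClosed_closure.smul_of_ne_zero (hr i).ne'
  obtain ⟨y, hy, hyd⟩ := hcl.exists_infDist_eq_dist ⟨0, zero_mem_inter_scaled h0 S⟩ z
  exact ⟨y, hy, hyd.symm⟩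

omit [FiniteDimensional ℝ E] [DecidableEq ι] in
lemma scaledDist_mono (h0 : ∀ i, (0 : E) ∈ interior (C i)) {S T : Finset ι} (hST : S ⊆ T) :
    scaledDist C z r S ≤ scaledDist C z r T :=
  infDist_le_infDist_of_subset (Set.biInter_subset_biInter_left hST)
    ⟨0, zero_mem_inter_scaled h0 T⟩

lemma scaledDist_locality (hC : ∀ i, Convex ℝ (C i)) (h0 : ∀ i, (0 : E) ∈ interior (C i))
    (hr : ∀ i, 0 < r i) {S T : Finset ι} (hST : S ⊆ T)
    (h : ∀ x ∈ T, scaledDist C z r (insert x S) = scaledDist C z r S) :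
    scaledDist C z r T = scaledDist C z r S := by
  refine le_antisymm ?_ (scaledDist_mono h0 hST)
  obtain ⟨y, hy, hyd⟩ := exists_dist_eq_scaledDist (z := z) h0 hr S
  rw [← hyd]
  refine infDist_le_dist_of_mem (Set.mem_iInter₂.2 fun x hx => ?_)
  obtain ⟨u, hu, hud⟩ := exists_dist_eq_scaledDist (z := z) h0 hr (insert x S)
  have huy : u = y := eq_of_dist_eq_infDist (convex_inter_scaled hC S)
    (Set.biInter_subset_biInter_left (Finset.subset_insert x S) hu) hy (hud.trans (h x hx)) hyd
  rw [← huy]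
  exact Set.mem_iInter₂.1 hu x (Finset.mem_insert_self _ _)

omit [DecidableEq ι] in
lemma scaledDist_exists_small (hC : ∀ i, Convex ℝ (C i)) (h0 : ∀ i, (0 : E) ∈ interior (C i))
    (hr : ∀ i, 0 < r i) (T : Finset ι) :
    ∃ I ⊆ T, #I ≤ finrank ℝ E ∧ scaledDist C z r I = scaledDist C z r T := by
  obtain ⟨I, hI, hmax⟩ := exists_max_image ({I ∈ T.powerset | #I ≤ finrank ℝ E})
    (scaledDist C z r) ⟨∅, by simp⟩
  simp only [Finset.mem_filter, Finset.mem_powerset] at hI hmax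
  refine ⟨I, hI.1, hI.2, le_antisymm (scaledDist_mono h0 hI.1) ?_⟩
  obtain ⟨y, hyL, hy⟩ := helly_inter_nonempty (s := T) (F := fun i => r i • closure (C i))
    (L := closedBall z (scaledDist C z r I))
    (fun i _ => (hC i).closure.smul _) (convex_closedBall _ _)
    (fun J _ _ => ⟨0, zero_mem_inter_scaled h0 J⟩)
    (fun J hJ hJc => by
      obtain ⟨y, hy, hyd⟩ := exists_dist_eq_scaledDist (z := z) h0 hr J
      exact ⟨y, by rw [mem_closedBall', hyd]; exact hmax J ⟨hJ, hJc⟩, hy⟩)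
  rw [mem_closedBall'] at hyL
  exact (infDist_le_dist_of_mem hy).trans hyL

/-- Shrinking an essential constraint strictly increases the distance: otherwise the nearest point
of the shrunk problem lies in the interior of the original constraint, which can then be dropped. -/
lemma scaledDist_lt_of_shrink (hC : ∀ i, Convex ℝ (C i)) (h0 : ∀ i, (0 : E) ∈ interior (C i))
    (hr : ∀ i, 0 < r i) {r' : ι → ℝ} {I : Finset ι} {x : ι} (hx : x ∈ I)
    (hlt : r x < r' x) (heq : ∀ i ≠ x, r i = r' i)
    (hess : scaledDist C z r' (I.erase x) < scaledDist C z r' I) :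
    scaledDist C z r' I < scaledDist C z r I := by
  have hr' : ∀ i, 0 < r' i := fun i => by
    by_cases hi : i = x
    · subst hi; exact (hr i).trans hlt
    · rw [← heq i hi]; exact hr i
  obtain ⟨y, hy, hyd⟩ := exists_dist_eq_scaledDist (z := z) h0 hr I
  obtain ⟨u, hu, hud⟩ := exists_dist_eq_scaledDist (z := z) h0 hr' (I.erase x)
  rw [Set.mem_iInter₂] at hy
  have hyx : y ∈ interior (r' x • closure (C x)) :=
    smul_closure_subset_interior (hC x) (h0 x) (hr x) hlt (hy x hx)
  have hye : y ∈ ⋂ i ∈ I.erase x, r' i • closure (C i) := Set.mem_iInter₂.2 fun i hi => by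
    rw [← heq i (Finset.mem_erase.1 hi).1]; exact hy i (Finset.mem_erase.1 hi).2
  have hyI : scaledDist C z r' I ≤ dist z y := infDist_le_dist_of_mem
    (Set.mem_iInter₂.2 fun i hi => by
      by_cases hix : i = x
      · subst hix; exact interior_subset hyx
      · exact Set.mem_iInter₂.1 hye i (Finset.mem_erase.2 ⟨hix, hi⟩))
  have huy : dist z u < dist z y := by rw [hud]; exact hess.trans_le hyI
  have hev : ∀ᶠ s : ℝ in nhdsWithin 0 (Ioi 0), (1 - s) • y + s • u ∈ r' x • closure (C x) := by
    have hcont : Continuous fun s : ℝ => (1 - s) • y + s • u := by fun_prop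
    have h1 := hcont.tendsto 0
    simp only [sub_zero, one_smul, zero_smul, add_zero] at h1
    exact (h1.mono_left nhdsWithin_le_nhds).eventually
      (mem_interior_iff_mem_nhds.1 hyx)
  obtain ⟨s, hs, hs0, hs1⟩ := (hev.and (Ioo_mem_nhdsGT (zero_lt_one' ℝ))).exists
  have hmem : (1 - s) • y + s • u ∈ ⋂ i ∈ I, r' i • closure (C i) :=
    Set.mem_iInter₂.2 fun i hi => by
      by_cases hix : i = x
      · subst hix; exact hs
      · exact Set.mem_iInter₂.1 (convex_inter_scaled hC _ hye hu (by linarith) hs0.le (by ring)) i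
          (Finset.mem_erase.2 ⟨hix, hi⟩)
  refine (infDist_le_dist_of_mem hmem).trans_lt ?_
  rw [← hyd, dist_comm, dist_eq_norm]
  have hdec : (1 - s) • y + s • u - z = (1 - s) • (y - z) + s • (u - z) := by module
  rw [hdec]
  refine (norm_add_le _ _).trans_lt ?_
  rw [norm_smul, norm_smul, ← dist_eq_norm y, ← dist_eq_norm u, dist_comm y, dist_comm u,
    Real.norm_of_nonneg (by linarith), Real.norm_of_nonneg hs0.le]
  nlinarith

end

/-- Nondegeneracy holds for generic factors: two distinct irredundant sets `I`, `J` with the same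
value have an element `x` in exactly one of them, and the value of the other one does not depend on
`r x`, so that on each line in direction `x` at most one point is bad. -/
lemma exists_nondegenerate_scaledDist [Fintype ι] {C : ι → Set E} (hC : ∀ i, Convex ℝ (C i))
    (h0 : ∀ i, (0 : E) ∈ interior (C i)) (z : E) {r₀ : ℝ} (hr₀ : 0 < r₀) (hr₁ : r₀ < 1) :
    ∃ r : ι → ℝ, (∀ i, r i ∈ Ioo r₀ 1) ∧
      IsNondegenerateLPType (finrank ℝ E) (scaledDist C z r) := by
  let bad : Finset ι × Finset ι × ι → Set (ι → ℝ) := fun b =>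
    {r | b.2.2 ∈ b.1 ∧ b.2.2 ∉ b.2.1 ∧ scaledDist C z r b.1 = scaledDist C z r b.2.1 ∧
      scaledDist C z r (b.1.erase b.2.2) ≠ scaledDist C z r b.1}
  obtain ⟨r, hrA, hrb⟩ := exists_generic bad (fun b => b.2.2) (A := Ioo r₀ 1) (Ioo_infinite hr₁) (by
    have key : ∀ (I J : Finset ι) (x : ι), ∀ r r' : ι → ℝ, x ∈ I → x ∉ J →
        scaledDist C z r I = scaledDist C z r J → scaledDist C z r' I = scaledDist C z r' J →
        scaledDist C z r' (I.erase x) ≠ scaledDist C z r' I → (∀ i, r i ∈ Ioo r₀ 1) →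
        (∀ i ≠ x, r i = r' i) → ¬ r x < r' x := by
      intro I J x r r' hxI hxJ h1 h2 h3 hr heq hlt
      have h4 := scaledDist_lt_of_shrink hC h0 (fun i => hr₀.trans (hr i).1) hxI hlt heq
        (lt_of_le_of_ne (scaledDist_mono h0 (Finset.erase_subset _ _)) h3)
      have h5 : scaledDist C z r J = scaledDist C z r' J := by
        unfold scaledDist
        congr 1
        refine Set.iInter₂_congr fun i hi => ?_
        rw [heq i (fun hix => hxJ (hix ▸ hi))]
      rw [h1, h2, h5] at h4
      exact lt_irrefl _ h4
    rintro ⟨I, J, x⟩ r ⟨h1, h2, h3, h4⟩ r' ⟨-, -, h3', h4'⟩ hrA hrA' heq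
    funext i
    by_cases hi : i = x
    · subst hi
      exact le_antisymm
        (not_lt.1 (key I J i r' r h1 h2 h3' h3 h4 hrA' fun j hj => (heq j hj).symm))
        (not_lt.1 (key I J i r r' h1 h2 h3 h3' h4' hrA heq))
    · exact heq i hi)
  have hr : ∀ i, 0 < r i := fun i => hr₀.trans (hrA i).1
  refine ⟨r, hrA, fun S T => scaledDist_mono h0, fun S T => scaledDist_locality hC h0 hr,
    scaledDist_exists_small hC h0 hr, ?_⟩
  have key : ∀ I J, (∀ x ∈ I, scaledDist C z r (I.erase x) ≠ scaledDist C z r I) →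
      scaledDist C z r I = scaledDist C z r J → I ⊆ J := by
    intro I J hI hIJ x hx
    by_contra hxJ
    exact hrb (I, J, x) ⟨hx, hxJ, hIJ, hI x hx⟩
  exact fun I J hI hJ hIJ => Finset.Subset.antisymm (key I J hI hIJ) (key J I hJ hIJ.symm)

/-- Every finite family of convex constraints with a common interior point and a linear objective
has a nondegenerate perturbation which keeps all violations: whenever adding `x` to `S` raises the
optimal value, it raises the perturbed value as well. -/
theorem exists_nondegenerate_perturbation [Fintype ι] {C : ι → Set E} (hC : ∀ i, Convex ℝ (C i))
    (h0 : ∀ i, (0 : E) ∈ interior (C i)) (c : E) :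
    ∃ D : Finset ι → ℝ, IsNondegenerateLPType (finrank ℝ E) D ∧
      ∀ S x, (∃ θ₀ ∈ ⋂ i ∈ S, C i, ∃ v, ⟪c, θ₀⟫ < v ∧ ∀ θ ∈ ⋂ i ∈ insert x S, C i, v ≤ ⟪c, θ⟫) →
        D S < D (insert x S) := by
  -- The pairs whose violation has to survive; they are finitely many, so that one shrinking factor
  -- `s` and one distance `R` serve them all.
  let Viol := {p : Finset ι × ι //
    ∃ θ₀ ∈ ⋂ i ∈ p.1, C i, ∃ v, ⟪c, θ₀⟫ < v ∧ ∀ θ ∈ ⋂ i ∈ insert p.2 p.1, C i, v ≤ ⟪c, θ⟫}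
  choose θ₀ hθ₀ v hv hvle using fun p : Viol => p.2
  have hev : ∀ᶠ s : ℝ in nhdsWithin 1 (Iio 1), ∀ p : Viol, ⟪c, s • θ₀ p⟫ < v p := by
    rw [Filter.eventually_all]
    intro p
    have hcont : Continuous fun s : ℝ => ⟪c, s • θ₀ p⟫ := by fun_prop
    have h1 := (hcont.tendsto 1).mono_left (nhdsWithin_le_nhds (s := Iio 1))
    rw [one_smul] at h1
    exact h1.eventually (gt_mem_nhds (hv p))
  obtain ⟨s, hs, hs0, hs1⟩ := (hev.and (Ioo_mem_nhdsLT (zero_lt_one' ℝ))).exists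
  have hevR : ∀ᶠ R : ℝ in Filter.atTop, ∀ p : Viol,
      ‖s • θ₀ p‖ ^ 2 < R * (2 * (v p - ⟪c, s • θ₀ p⟫)) := by
    rw [Filter.eventually_all]
    intro p
    exact (Filter.tendsto_id.atTop_mul_const (by have := hs p; linarith)).eventually_gt_atTop _
  obtain ⟨R, hR, hR0⟩ := (hevR.and (Filter.eventually_ge_atTop 0)).exists
  obtain ⟨r, hr, hD⟩ := exists_nondegenerate_scaledDist hC h0 (-(R • c)) hs0 hs1
  refine ⟨_, hD, fun S x hSx => ?_⟩
  let p : Viol := ⟨(S, x), hSx⟩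
  have hr0 : ∀ i, 0 < r i := fun i => hs0.trans (hr i).1
  obtain ⟨y, hy, hyd⟩ := exists_dist_eq_scaledDist (z := -(R • c)) h0 hr0 (insert x S)
  have hyC : y ∈ ⋂ i ∈ insert x S, C i := Set.mem_iInter₂.2 fun i hi =>
    smul_closure_subset_self (hC i) (h0 i) (hr0 i) (hr i).2 (Set.mem_iInter₂.1 hy i hi)
  have h1 : s • θ₀ p ∈ ⋂ i ∈ S, r i • closure (C i) := Set.mem_iInter₂.2 fun i hi => by
    refine ⟨(s / r i) • θ₀ p, subset_closure ?_, ?_⟩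
    · have h2 := (hC i) (interior_subset (h0 i)) (Set.mem_iInter₂.1 (hθ₀ p) i hi)
        (a := 1 - s / r i) (b := s / r i)
        (by rw [sub_nonneg, div_le_one (hr0 i)]; exact (hr i).1.le)
        (div_nonneg hs0.le (hr0 i).le) (by ring)
      rwa [smul_zero, zero_add] at h2
    · have := (hr0 i).ne'
      simp only [smul_smul]; congr 1; field_simp
  rw [← hyd]
  refine (infDist_le_dist_of_mem h1).trans_lt ?_
  have hsq : ∀ θ : E, dist (-(R • c)) θ ^ 2 = ‖θ‖ ^ 2 + R * (2 * ⟪c, θ⟫) + R ^ 2 * ‖c‖ ^ 2 := by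
    intro θ
    rw [dist_comm, dist_eq_norm, sub_neg_eq_add, norm_add_sq_real, inner_smul_right,
      real_inner_comm, norm_smul, mul_pow, Real.norm_eq_abs, sq_abs]
    ring
  refine lt_of_pow_lt_pow_left₀ 2 dist_nonneg ?_
  rw [hsq, hsq]
  have h3 : v p ≤ ⟪c, y⟫ := hvle p y hyC
  have h4 := hR p
  have h5 : R * (2 * v p) ≤ R * (2 * ⟪c, y⟫) := by gcongr
  nlinarith [sq_nonneg ‖y‖]

end Perturbation

/-! ### Existence and uniqueness of optimal solutions for all sample sizes -/

section Optimal

open Finset Module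

variable {E W : Type*} [NormedAddCommGroup E] [NormedSpace ℝ E] [FiniteDimensional ℝ E]

/-- `θ` minimizes `ℓ` subject to the constraints `C w`, `w ∈ S`. -/
def IsOptimalFor (C : W → Set E) (ℓ : E →ₗ[ℝ] ℝ) (S : Finset W) (θ : E) : Prop :=
  θ ∈ ⋂ w ∈ S, C w ∧ ∀ θ' ∈ ⋂ w ∈ S, C w, ℓ θ ≤ ℓ θ'

/-- If all sets of at most `finrank ℝ E + 1` constraints have an intersection with nonempty interior
and a unique optimal solution, then so do all finite sets of constraints. -/
theorem interior_nonempty_and_existsUnique_isOptimalFor {C : W → Set E} (hC : ∀ w, Convex ℝ (C w))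
    {ℓ : E →ₗ[ℝ] ℝ} (hE : 1 ≤ finrank ℝ E)
    (h : ∀ S : Finset W, S.Nonempty → #S ≤ finrank ℝ E + 1 →
      (interior (⋂ w ∈ S, C w)).Nonempty ∧ ∃! θ, IsOptimalFor C ℓ S θ)
    {S : Finset W} (hS : S.Nonempty) :
    (interior (⋂ w ∈ S, C w)).Nonempty ∧ ∃! θ, IsOptimalFor C ℓ S θ := by
  have hint : ∀ S : Finset W, interior (⋂ w ∈ S, C w) = ⋂ w ∈ S, interior (C w) := fun S =>
    S.finite_toSet.interior_biInter _
  constructor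
  · rw [hint]
    refine Convex.helly_theorem' (𝕜 := ℝ) (fun w _ => (hC w).interior) fun I _ hc => ?_
    rcases I.eq_empty_or_nonempty with rfl | hI
    · exact ⟨0, by simp⟩
    · rw [← hint]; exact (h I hI hc).1
  have hex : ∀ I : Finset W, ∃ θ, I.Nonempty → #I ≤ finrank ℝ E + 1 → IsOptimalFor C ℓ I θ := by
    intro I
    by_cases hI : I.Nonempty ∧ #I ≤ finrank ℝ E + 1
    · obtain ⟨θ, hθ, -⟩ := (h I hI.1 hI.2).2
      exact ⟨θ, fun _ _ => hθ⟩
    · exact ⟨0, fun h1 h2 => absurd ⟨h1, h2⟩ hI⟩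
  choose θ hθ using hex
  obtain ⟨w₀, hw₀⟩ := hS
  -- The optimal solution of `S` is that of a subset `I` of size at most `finrank ℝ E` with the
  -- largest optimal value.
  obtain ⟨I, hI, hmax⟩ := exists_max_image
    ({I ∈ S.powerset | I.Nonempty ∧ #I ≤ finrank ℝ E}) (fun I => ℓ (θ I))
    ⟨{w₀}, by simp [hw₀, hE]⟩
  simp only [Finset.mem_filter, Finset.mem_powerset] at hI hmax
  obtain ⟨hIS, hIne, hIc⟩ := hI
  have hI' := hθ I hIne (by omega)
  have huniq := (h I hIne (by omega)).2
  obtain ⟨y, hyL, hy⟩ := helly_inter_nonempty (s := S) (F := C) (L := {y | ℓ y ≤ ℓ (θ I)})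
    (fun w _ => hC w) (convex_halfSpace_le ℓ.isLinear _)
    (fun J _ hJc => by
      rcases J.eq_empty_or_nonempty with rfl | hJ
      · exact ⟨0, by simp⟩
      · exact ⟨_, (hθ J hJ hJc).1⟩)
    (fun J hJS hJc => by
      rcases J.eq_empty_or_nonempty with rfl | hJ
      · exact ⟨θ I, by simp⟩
      · exact ⟨θ J, hmax J ⟨hJS, hJ, hJc⟩, (hθ J hJ (by omega)).1⟩)
  have hyI : y ∈ ⋂ w ∈ I, C w := Set.biInter_subset_biInter_left hIS hy
  have hopt : ∀ u ∈ ⋂ w ∈ I, C w, ℓ u ≤ ℓ (θ I) → IsOptimalFor C ℓ I u := fun u hu hle =>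
    ⟨hu, fun θ' hθ' => hle.trans (hI'.2 θ' hθ')⟩
  have hyopt : IsOptimalFor C ℓ S y := ⟨hy, fun θ' hθ' => (hopt y hyI hyL).2 θ'
    (Set.biInter_subset_biInter_left hIS hθ')⟩
  refine ⟨y, hyopt, fun u hu => ?_⟩
  exact huniq.unique (hopt u (Set.biInter_subset_biInter_left hIS hu.1)
    ((hu.2 y hy).trans hyL)) (hopt y hyI hyL)

end Optimal

/-! ### Counting violations in finitely many convex constraints -/

section ConvexCount

open Finset
open scoped RealInnerProductSpace

/-- The counting bound for a possibly degenerate convex program, obtained from a nondegenerate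
perturbation after moving a common interior point to the origin. -/
theorem card_many_violators_convex_le {n : ℕ} {ι : Type*} [Fintype ι] [DecidableEq ι]
    {C : ι → Set (Fin n → ℝ)} (hC : ∀ i, Convex ℝ (C i))
    (hint : (interior (⋂ i, C i)).Nonempty) (c : Fin n → ℝ) {V : Finset ι → ℝ}
    (hV : ∀ S : Finset ι, S.Nonempty → IsLeast ((c ⬝ᵥ ·) '' ⋂ i ∈ S, C i) (V S))
    {N k : ℕ} (hn : 1 ≤ n) (hN : n ≤ N) (hk : n + k ≤ Fintype.card ι) {a : ℝ} (ha : 1 ≤ a) :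
    (#{S ∈ powersetCard N (univ : Finset ι) | k < #{x ∈ Sᶜ | V S < V (insert x S)}} : ℝ) *
      N.factorial ≤ a ^ (n - 1) * (Fintype.card ι - (n + k : ℕ) * (1 - 1 / a)) ^ N := by
  obtain ⟨p, hp⟩ := hint
  let g : EuclideanSpace ℝ (Fin n) → (Fin n → ℝ) := fun y => WithLp.ofLp y + p
  have hg : Continuous g := by fun_prop
  have hgc : ∀ y, c ⬝ᵥ g y = ⟪WithLp.toLp 2 c, y⟫ + c ⬝ᵥ p := fun y => by
    simp only [g]
    rw [dotProduct_add, EuclideanSpace.inner_eq_star_dotProduct, dotProduct_comm]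
    simp
  have hgs : ∀ θ, g (WithLp.toLp 2 (θ - p)) = θ := fun θ => by simp [g]
  obtain ⟨D, hD, hDV⟩ := exists_nondegenerate_perturbation (C := fun i => g ⁻¹' C i)
    (fun i x hx y hy s t hs ht hst => by
      have h1 := hC i hx hy hs ht hst
      have h2 : g (s • x + t • y) = s • g x + t • g y := by
        simp only [g]
        have h3 : p = (s + t) • p := by rw [hst, one_smul]
        rw [WithLp.ofLp_add, WithLp.ofLp_smul, WithLp.ofLp_smul]
        nth_rewrite 1 [h3]
        module
      rw [Set.mem_preimage, h2]; exact h1)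
    (fun i => by
      refine preimage_interior_subset_interior_preimage hg ?_
      have h0 : g 0 = p := by simp [g]
      rw [Set.mem_preimage, h0]
      exact interior_mono (Set.iInter_subset _ i) hp) (WithLp.toLp 2 c)
  rw [finrank_euclideanSpace_fin] at hD
  refine le_trans ?_ (hD.card_many_violators_le hn hN hk ha)
  refine mul_le_mul_of_nonneg_right (Nat.cast_le.2 (card_le_card fun S hS => ?_)) (by positivity)
  obtain ⟨hS, hkS⟩ := Finset.mem_filter.1 hS
  refine Finset.mem_filter.2 ⟨hS, hkS.trans_le (card_le_card fun x hx => ?_)⟩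
  obtain ⟨hx, hlt⟩ := Finset.mem_filter.1 hx
  refine Finset.mem_filter.2 ⟨hx, ?_⟩
  have hSne : S.Nonempty := card_pos.1 (by have := (mem_powersetCard.1 hS).2; omega)
  obtain ⟨⟨θ, hθ, hθV⟩, -⟩ := hV S hSne
  have hins := (hV (insert x S) (insert_nonempty _ _)).2
  refine hDV S x ⟨WithLp.toLp 2 (θ - p), ?_, V (insert x S) - c ⬝ᵥ p, ?_, ?_⟩
  · rw [Set.mem_iInter₂] at hθ ⊢
    intro i hi
    rw [Set.mem_preimage, hgs]
    exact hθ i hi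
  · have h1 := hgc (WithLp.toLp 2 (θ - p))
    rw [hgs] at h1
    simp only at hθV
    linarith
  · intro y hy
    have h1 := hins ⟨g y, by rw [Set.mem_iInter₂] at hy ⊢; exact hy, rfl⟩
    simp only [hgc] at h1
    linarith

end ConvexCount

/-! ### Concentration of the number of violations among fresh samples -/

section Probability

open Finset ProbabilityTheory Filter

/-- Chebyshev's inequality: among `M` independent samples more than `κ M` fall into `Z` with high
probability if `Z` has probability greater than `κ`. -/
lemma one_sub_le_measureReal_card_hits {W : Type*} [MeasurableSpace W] (μ : Measure W)
    [IsProbabilityMeasure μ] {Z : Set W} (hZ : MeasurableSet Z) [DecidablePred (· ∈ Z)]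
    {M k : ℕ} {κ ε : ℝ} (hM : 0 < M)
    (hε : 0 < ε) (hk : (k : ℝ) ≤ κ * M) (hp : κ + ε ≤ μ.real Z) :
    1 - 1 / (M * ε ^ 2) ≤
      (Measure.pi fun _ : Fin M => μ).real {ω | k < #{j | ω j ∈ Z}} := by
  let P := Measure.pi fun _ : Fin M => μ
  let X : W → ℝ := Z.indicator 1
  have hXb : ∀ w, X w ∈ Icc (0 : ℝ) 1 := fun w => by
    by_cases hw : w ∈ Z <;> simp [X, hw]
  have hXm : Measurable X := measurable_one.indicator hZ
  have hX2 : MemLp X 2 μ := MemLp.of_bound hXm.aestronglyMeasurable 1 (ae_of_all _ fun w => by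
    rw [Real.norm_eq_abs, abs_le]; have := hXb w; constructor <;> linarith [this.1, this.2])
  let Y : (Fin M → W) → ℝ := ∑ j, fun ω => X (ω j)
  have hYm : ∀ j, MemLp (fun ω : Fin M → W => X (ω j)) 2 P := fun j =>
    hX2.comp_measurePreserving (measurePreserving_eval (fun _ => μ) j)
  have hY2 : MemLp Y 2 P := memLp_finsetSum' _ fun j _ => hYm j
  have hYc : ∀ ω, Y ω = #{j | ω j ∈ Z} := fun ω => by
    simp [Y, X, Finset.sum_apply, Set.indicator_apply]
  have hvar : Var[Y; P] ≤ M := by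
    rw [variance_sum_pi (fun _ => hX2)]
    refine (sum_le_sum fun j _ => (variance_le_sq_of_bounded (a := 0) (b := 1)
      (ae_of_all _ hXb) hXm.aemeasurable)).trans ?_
    simp; linarith [(Nat.cast_nonneg M : (0:ℝ) ≤ M)]
  have hmean : P[Y] = M * μ.real Z := by
    have h1 : ∀ j, ∫ ω, X (ω j) ∂P = μ.real Z := fun j => by
      have h2 := (measurePreserving_eval (fun _ : Fin M => μ) j).map_eq
      have h3 := integral_map (μ := P) (φ := Function.eval j) (f := X)
        (measurable_pi_apply j).aemeasurable hXm.aestronglyMeasurable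
      rw [h2] at h3
      simp only [Function.eval] at h3
      rw [← h3]; simp [X, integral_indicator_one hZ]
    simp only [Y, Finset.sum_apply]
    rw [integral_finsetSum _ fun j _ => (hYm j).integrable (by norm_num)]
    simp [h1]
  have hM' : (0 : ℝ) < M := by exact_mod_cast hM
  have hcheb := meas_ge_le_variance_div_sq hY2 (c := M * ε) (by positivity)
  have hsub : {ω : Fin M → W | k < #{j | ω j ∈ Z}}ᶜ ⊆ {ω | M * ε ≤ |Y ω - P[Y]|} := by
    intro ω hω
    simp only [Set.mem_compl_iff, Set.mem_ofPred_eq, not_lt] at hω ⊢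
    have h1 : Y ω ≤ k := by rw [hYc]; exact_mod_cast hω
    rw [hmean, abs_sub_comm]
    refine le_trans ?_ (le_abs_self _)
    nlinarith
  have hmeas : MeasurableSet {ω : Fin M → W | k < #{j | ω j ∈ Z}} := by
    have h1 : Measurable Y := by
      have h3 : Y = fun ω => ∑ j, X (ω j) := by ext ω; simp [Y, Finset.sum_apply]
      rw [h3]
      exact Finset.measurable_sum _ fun j _ => hXm.comp (measurable_pi_apply j)
    have h2 : {ω : Fin M → W | k < #{j | ω j ∈ Z}} = {ω | (k : ℝ) < Y ω} := by
      ext ω; simp [hYc]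
    rw [h2]
    exact measurableSet_lt measurable_const h1
  have h1 : P.real {ω : Fin M → W | k < #{j | ω j ∈ Z}}ᶜ ≤ 1 / (M * ε ^ 2) := by
    refine ENNReal.toReal_le_of_le_ofReal (by positivity) ?_
    refine (measure_mono hsub).trans (hcheb.trans (ENNReal.ofReal_le_ofReal ?_))
    rw [div_le_div_iff₀ (by positivity) (by positivity)]
    nlinarith [sq_nonneg (M * ε), mul_le_mul_of_nonneg_right hvar (by positivity : 0 ≤ M * ε ^ 2)]
  rw [probReal_compl_eq_one_sub hmeas] at h1
  linarith

end Probability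

/-! ### Exchangeability of the samples -/

section Exchangeability

open Finset ProbabilityTheory Filter Topology

variable {W : Type*} [DecidableEq W]

/-- The event that more than `k` samples outside `S` raise the value of the samples in `S`. -/
def manyViolators {ι : Type*} [Fintype ι] [DecidableEq ι] (V : Finset W → ℝ) (k : ℕ)
    (S : Finset ι) : Set (ι → W) :=
  {ω | k < #{x ∈ Sᶜ | V (S.image ω) < V ((insert x S).image ω)}}

variable [MeasurableSpace W] {V : Finset W → ℝ}

lemma measurableSet_manyViolators {ι : Type*} [Fintype ι] [DecidableEq ι]
    (hV : ∀ S : Finset ι, S.Nonempty → Measurable fun ω : ι → W => V (S.image ω))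
    (k : ℕ) {S : Finset ι} (hS : S.Nonempty) : MeasurableSet (manyViolators V k S) := by
  have h1 : ∀ x, MeasurableSet {ω : ι → W | V (S.image ω) < V ((insert x S).image ω)} := fun x =>
    measurableSet_lt (hV S hS) (hV _ (insert_nonempty _ _))
  have h2 : Measurable fun ω : ι → W => #{x ∈ Sᶜ | V (S.image ω) < V ((insert x S).image ω)} := by
    simp only [card_filter]
    exact Finset.measurable_sum _ fun x _ =>
      Measurable.ite (h1 x) measurable_const measurable_const
  exact measurableSet_lt measurable_const h2

variable (μ : Measure W) [IsProbabilityMeasure μ]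

lemma measureReal_manyViolators_eq {ι : Type*} [Fintype ι] [DecidableEq ι]
    (k : ℕ) {S T : Finset ι} (hST : #S = #T) :
    (Measure.pi fun _ : ι => μ).real (manyViolators V k S) =
      (Measure.pi fun _ : ι => μ).real (manyViolators V k T) := by
  let e : {x // x ∈ T} ≃ {x // x ∈ S} := Fintype.equivOfCardEq (by simp [hST])
  let σ : Equiv.Perm ι := e.extendSubtype
  have hσ : ∀ x, σ x ∈ S ↔ x ∈ T := fun x => by
    constructor
    · intro h; by_contra hx; exact e.extendSubtype_not_mem x hx h
    · exact e.extendSubtype_mem x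
  have himg : T.image σ = S := by
    ext y
    simp only [Finset.mem_image]
    constructor
    · rintro ⟨x, hx, rfl⟩; exact (hσ x).2 hx
    · intro hy; exact ⟨σ.symm y, (hσ _).1 (by simpa using hy), by simp⟩
  have hmp := measurePreserving_piCongrLeft (fun _ : ι => μ) σ.symm
  have hpre : MeasurableEquiv.piCongrLeft (fun _ : ι => W) σ.symm ⁻¹' manyViolators V k T =
      manyViolators V k S := by
    ext ω
    have h1 : MeasurableEquiv.piCongrLeft (fun _ : ι => W) σ.symm ω = ω ∘ σ := by
      funext x
      rw [MeasurableEquiv.coe_piCongrLeft]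
      have := Equiv.piCongrLeft_apply_apply (fun _ : ι => W) σ.symm ω (σ x)
      simpa using this
    rw [Set.mem_preimage, h1]
    simp only [manyViolators, Set.mem_ofPred_eq]
    have h2 : ∀ U : Finset ι, U.image (ω ∘ σ) = (U.image σ).image ω := fun U => by
      rw [Finset.image_image]
    have h3 : #{x ∈ Tᶜ | V (T.image (ω ∘ σ)) < V ((insert x T).image (ω ∘ σ))} =
        #{x ∈ Sᶜ | V (S.image ω) < V ((insert x S).image ω)} := by
      refine card_bij (fun x _ => σ x) ?_ (fun x _ y _ h => σ.injective h) ?_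
      · intro x hx
        simp only [Finset.mem_filter, Finset.mem_compl] at hx ⊢
        rw [h2, h2, Finset.image_insert, himg] at hx
        exact ⟨fun h => hx.1 ((hσ x).1 h), hx.2⟩
      · intro y hy
        simp only [Finset.mem_filter, Finset.mem_compl] at hy
        refine ⟨σ.symm y, ?_, by simp⟩
        simp only [Finset.mem_filter, Finset.mem_compl]
        rw [h2, h2, Finset.image_insert, himg, Equiv.apply_symm_apply]
        exact ⟨fun h => hy.1 (by simpa using (hσ _).2 h), hy.2⟩
    rw [h3]
  rw [← hpre, measureReal_def, measureReal_def, hmp.measure_preimage_equiv]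

/-- All sets of samples of the same size are equally likely to have many violators, so the
probability is bounded by the average over these sets of the deterministic count. -/
lemma choose_mul_measureReal_manyViolators_le {ι : Type*} [Fintype ι] [DecidableEq ι]
    (hV : ∀ S : Finset ι, S.Nonempty → Measurable fun ω : ι → W => V (S.image ω))
    (k : ℕ) {S : Finset ι} (hS : S.Nonempty) {K : ℝ}
    (hK : ∀ ω : ι → W, (#{T ∈ powersetCard #S (univ : Finset ι) |
      k < #{x ∈ Tᶜ | V (T.image ω) < V ((insert x T).image ω)}} : ℝ) ≤ K) :
    (Fintype.card ι).choose #S * (Measure.pi fun _ : ι => μ).real (manyViolators V k S) ≤ K := by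
  set P := Measure.pi fun _ : ι => μ
  have hne : ∀ T ∈ powersetCard #S (univ : Finset ι), T.Nonempty := fun T hT => by
    rw [← card_pos, (mem_powersetCard.1 hT).2]; exact hS.card_pos
  have hmeas : ∀ T ∈ powersetCard #S (univ : Finset ι), MeasurableSet (manyViolators V k T) :=
    fun T hT => measurableSet_manyViolators hV k (hne T hT)
  have hint : ∀ T ∈ powersetCard #S (univ : Finset ι),
      Integrable ((manyViolators V k T).indicator (1 : (ι → W) → ℝ)) P := fun T hT =>
    (integrable_const (1 : ℝ)).indicator (hmeas T hT)
  calc _ = ∑ T ∈ powersetCard #S (univ : Finset ι), P.real (manyViolators V k T) := by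
        have h1 : ∀ T ∈ powersetCard #S (univ : Finset ι),
            P.real (manyViolators V k T) = P.real (manyViolators V k S) := fun T hT =>
          measureReal_manyViolators_eq μ k (mem_powersetCard.1 hT).2
        rw [sum_congr rfl h1, sum_const, card_powersetCard, card_univ, nsmul_eq_mul]
    _ = ∫ ω, ∑ T ∈ powersetCard #S (univ : Finset ι),
          (manyViolators V k T).indicator (1 : (ι → W) → ℝ) ω ∂P := by
        rw [integral_finsetSum _ hint]
        exact sum_congr rfl fun T hT => (integral_indicator_one (hmeas T hT)).symm
    _ ≤ ∫ _, K ∂P := by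
        refine integral_mono (integrable_finsetSum _ hint) (integrable_const K) fun ω => ?_
        refine le_trans (le_of_eq ?_) (hK ω)
        simp [Set.indicator_apply, manyViolators]
    _ = K := by simp

end Exchangeability

/-! ### The tail of the violation probability -/

section Limit

open Finset ProbabilityTheory Filter Topology

universe u

variable {W : Type u} [DecidableEq W] [MeasurableSpace W] (μ : Measure W) [IsProbabilityMeasure μ]
  {V : Finset W → ℝ}

/-- The set of constraints that raise the value `V S`. -/
def violatedBy (V : Finset W → ℝ) (S : Finset W) : Set W := {w | V S < V (insert w S)}

lemma measurableSet_violatedBy_prod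
    (hV : ∀ (ι : Type) (S : Finset ι), S.Nonempty → Measurable fun ω : ι → W => V (S.image ω))
    {N : ℕ} (hN : 0 < N) :
    MeasurableSet {p : (Fin N → W) × W | p.2 ∈ violatedBy V (Finset.univ.image p.1)} := by
  have h1 : Measurable fun p : (Fin N → W) × W => fun o : Option (Fin N) => o.elim p.2 p.1 := by
    refine measurable_pi_iff.2 fun o => ?_
    cases o with
    | none => exact measurable_snd
    | some i => exact (measurable_pi_apply i).comp measurable_fst
  have h2 : ∀ p : (Fin N → W) × W,
      (Finset.univ.map Function.Embedding.some).image (fun o : Option (Fin N) => o.elim p.2 p.1) =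
        Finset.univ.image p.1 := fun p => by
    ext w; simp
  have h3 : ∀ p : (Fin N → W) × W,
      Finset.univ.image (fun o : Option (Fin N) => o.elim p.2 p.1) =
        insert p.2 (Finset.univ.image p.1) :=
    fun p => by
      ext w; simp [Option.exists, eq_comm]
  have h4 := (hV _ (Finset.univ.map Function.Embedding.some) (by
    simpa using Finset.univ_nonempty_iff.2 ⟨⟨0, hN⟩⟩)).comp h1
  have h5 := (hV (Option (Fin N)) univ Finset.univ_nonempty).comp h1
  have h6 := measurableSet_lt h4 h5
  simp only [Function.comp_def, h2, h3] at h6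
  exact h6

/-- Among `N + M` samples, the first `N` have more than `k ≤ κ M` violators with high probability
given that their violation probability is at least `κ + ε`; on the other hand, a bound `K` on the
number of `N`-sets with more than `k` violators makes this unlikely. -/
theorem choose_mul_measureReal_violation_ge_le
    (hV : ∀ (ι : Type) (S : Finset ι), S.Nonempty → Measurable fun ω : ι → W => V (S.image ω))
    {N M k : ℕ} (hN : 0 < N) (hM : 0 < M) {κ ε K : ℝ} (hε : 0 < ε) (hk : (k : ℝ) ≤ κ * M)
    (hK : ∀ ω : Fin N ⊕ Fin M → W, (#{T ∈ powersetCard N (univ : Finset (Fin N ⊕ Fin M)) |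
      k < #{x ∈ Tᶜ | V (T.image ω) < V ((insert x T).image ω)}} : ℝ) ≤ K) :
    ((N + M).choose N : ℝ) * ((1 - 1 / (M * ε ^ 2)) * (Measure.pi fun _ : Fin N => μ).real
      {ω | κ + ε ≤ μ.real (violatedBy V (Finset.univ.image ω))}) ≤ K := by
  classical
  let S₀ : Finset (Fin N ⊕ Fin M) := Finset.univ.map Function.Embedding.inl
  have hS₀c : #S₀ = N := by simp [S₀]
  have hS₀ : S₀.Nonempty := card_pos.1 (by omega)
  have h1 := choose_mul_measureReal_manyViolators_le μ (hV (Fin N ⊕ Fin M)) k hS₀ (K := K)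
    (by rw [hS₀c]; exact hK)
  rw [hS₀c, Fintype.card_sum, Fintype.card_fin, Fintype.card_fin] at h1
  refine le_trans (mul_le_mul_of_nonneg_left ?_ (Nat.cast_nonneg _)) h1
  set P := Measure.pi fun _ : Fin N => μ
  set Q := Measure.pi fun _ : Fin M => μ
  have hmp := measurePreserving_sumPiEquivProdPi (fun _ : Fin N ⊕ Fin M => μ)
  have hZ := measurableSet_violatedBy_prod hV hN
  have hZω : ∀ ω : Fin N → W, MeasurableSet (violatedBy V (Finset.univ.image ω)) := fun ω =>
    measurable_prodMk_left hZ
  let G : Set (Fin N → W) := {ω | κ + ε ≤ μ.real (violatedBy V (Finset.univ.image ω))}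
  have hG : MeasurableSet G :=
    measurableSet_le measurable_const (measurable_measure_prodMk_left hZ).ennreal_toReal
  let A : Set ((Fin N → W) × (Fin M → W)) :=
    {p | k < #{j | p.2 j ∈ violatedBy V (Finset.univ.image p.1)}}
  have hpre : (MeasurableEquiv.sumPiEquivProdPi fun _ : Fin N ⊕ Fin M => W) ⁻¹' A =
      manyViolators V k S₀ := by
    ext ω
    have himg : S₀.image ω = Finset.univ.image fun i => ω (Sum.inl i) := by
      ext w; simp [S₀]
    have hcard : #{x ∈ S₀ᶜ | V (S₀.image ω) < V ((insert x S₀).image ω)} =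
        #{j : Fin M | ω (Sum.inr j) ∈ violatedBy V (Finset.univ.image fun i => ω (Sum.inl i))} := by
      symm
      refine card_bij (fun j _ => Sum.inr j) ?_ (fun i _ j _ h => Sum.inr_injective h) ?_
      · intro j hj
        have hj' := (Finset.mem_filter.1 hj).2
        refine Finset.mem_filter.2 ⟨by simp [S₀], ?_⟩
        rw [Finset.image_insert, himg]
        exact hj'
      · intro x hx
        obtain ⟨hx1, hx2⟩ := Finset.mem_filter.1 hx
        cases x with
        | inl i => simp [S₀] at hx1
        | inr j =>
          refine ⟨j, Finset.mem_filter.2 ⟨Finset.mem_univ _, ?_⟩, rfl⟩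
          rw [Finset.image_insert, himg] at hx2
          exact hx2
    simp only [manyViolators, Set.mem_ofPred_eq, Set.mem_preimage, A, hcard]
    rfl
  have hmA : MeasurableSet A := by
    have h2 := measurableSet_manyViolators (hV (Fin N ⊕ Fin M)) k hS₀
    rw [← hpre] at h2
    exact (MeasurableEquiv.measurableSet_preimage _).1 h2
  have hPA : (Measure.pi fun _ : Fin N ⊕ Fin M => μ).real (manyViolators V k S₀) =
      (P.prod Q).real A := by
    rw [← hpre, measureReal_def, hmp.measure_preimage_equiv, measureReal_def]
  rw [hPA]
  have hprod : (P.prod Q).real A = ∫ ω, Q.real (Prod.mk ω ⁻¹' A) ∂P := by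
    rw [measureReal_def, Measure.prod_apply hmA, integral_eq_lintegral_of_nonneg_ae
      (ae_of_all _ fun _ => measureReal_nonneg)
      (measurable_measure_prodMk_left hmA).ennreal_toReal.aestronglyMeasurable]
    simp
  have hint : Integrable (fun ω => Q.real (Prod.mk ω ⁻¹' A)) P := by
    refine Integrable.of_bound
      (measurable_measure_prodMk_left hmA).ennreal_toReal.aestronglyMeasurable 1
      (ae_of_all _ fun ω => ?_)
    rw [Real.norm_of_nonneg measureReal_nonneg]
    exact measureReal_le_one
  rw [hprod]
  calc _ = ∫ ω, G.indicator (fun _ => 1 - 1 / (M * ε ^ 2)) ω ∂P := by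
        rw [integral_indicator_const _ hG, smul_eq_mul, mul_comm]
    _ ≤ _ := by
        refine integral_mono ((integrable_const _).indicator hG) hint fun ω => ?_
        by_cases hω : ω ∈ G
        · rw [Set.indicator_of_mem hω]
          exact one_sub_le_measureReal_card_hits μ (hZω ω) hM hε hk hω
        · rw [Set.indicator_of_notMem hω]
          exact measureReal_nonneg

/-- The bound for `N + M` samples with threshold `k = ⌊η M⌋`, in the limit `M → ∞`. -/
theorem measureReal_violation_ge_le {n : ℕ}
    (hV : ∀ (ι : Type) (S : Finset ι), S.Nonempty → Measurable fun ω : ι → W => V (S.image ω))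
    {N : ℕ} (hn : 1 ≤ n) (hN : n ≤ N) {a : ℝ} (ha : 1 ≤ a)
    (hcount : ∀ (ι : Type) [Fintype ι] [DecidableEq ι] (ω : ι → W) (k : ℕ),
      n + k ≤ Fintype.card ι → (#{S ∈ powersetCard N (univ : Finset ι) |
        k < #{x ∈ Sᶜ | V (S.image ω) < V ((insert x S).image ω)}} : ℝ) * N.factorial ≤
          a ^ (n - 1) * (Fintype.card ι - (n + k : ℕ) * (1 - 1 / a)) ^ N)
    {η ε : ℝ} (hη : η ∈ Ioo (0 : ℝ) 1) (hε : 0 < ε) :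
    (Measure.pi fun _ : Fin N => μ).real {ω | η + ε ≤ μ.real (violatedBy V (Finset.univ.image ω))} ≤
      a ^ (n - 1) * (1 - η * (1 - 1 / a)) ^ N := by
  set p := (Measure.pi fun _ : Fin N => μ).real
    {ω | η + ε ≤ μ.real (violatedBy V (Finset.univ.image ω))} with hp
  have ha1 : 0 ≤ 1 - 1 / a := by
    rw [sub_nonneg, div_le_one (by linarith)]; exact ha
  have ha2 : 1 - 1 / a ≤ 1 := by
    have : 0 ≤ 1 / a := by positivity
    linarith
  have hL : Tendsto (fun M : ℕ => (1 - 1 / ((M : ℝ) * ε ^ 2)) * p) atTop (𝓝 ((1 - 0) * p)) := by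
    refine (tendsto_const_nhds.sub ?_).mul_const p
    refine tendsto_const_nhds.div_atTop ?_
    exact tendsto_natCast_atTop_atTop.atTop_mul_const (by positivity)
  have hR : Tendsto (fun M : ℕ => a ^ (n - 1) * ((N : ℝ) / M + (1 - η * (1 - 1 / a))) ^ N) atTop
      (𝓝 (a ^ (n - 1) * (0 + (1 - η * (1 - 1 / a))) ^ N)) := by
    refine (((tendsto_const_nhds.div_atTop tendsto_natCast_atTop_atTop).add_const
      _).pow N).const_mul _
  rw [sub_zero, one_mul] at hL
  rw [zero_add] at hR
  refine le_of_tendsto_of_tendsto hL hR ?_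
  filter_upwards [eventually_gt_atTop 0] with M hM
  have hM' : (0 : ℝ) < M := by exact_mod_cast hM
  let k := ⌊η * M⌋₊
  have hk : (k : ℝ) ≤ η * M := Nat.floor_le (by have := hη.1; positivity)
  have hk' : η * M < k + 1 := Nat.lt_floor_add_one _
  have hkM : k ≤ M := by
    have : (k : ℝ) ≤ M := hk.trans (by nlinarith [hη.2])
    exact_mod_cast this
  have hcard : Fintype.card (Fin N ⊕ Fin M) = N + M := by simp
  have h1 := choose_mul_measureReal_violation_ge_le μ hV (by omega : 0 < N) hM hε hk
    (K := a ^ (n - 1) * ((N + M : ℕ) - (n + k : ℕ) * (1 - 1 / a)) ^ N / N.factorial) (fun ω => by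
      rw [le_div_iff₀ (by positivity)]
      have := hcount (Fin N ⊕ Fin M) ω k (by rw [hcard]; omega)
      rwa [hcard] at this)
  rw [le_div_iff₀ (by positivity), ← hp] at h1
  have h2 : (M : ℝ) ^ N ≤ (N + M).choose N * N.factorial := by
    have h3 := Nat.pow_sub_le_descFactorial (N + M) N
    rw [Nat.descFactorial_eq_factorial_mul_choose] at h3
    have h4 : M ^ N ≤ (N + M + 1 - N) ^ N := Nat.pow_le_pow_left (by omega) N
    have h5 := h4.trans h3
    rw [mul_comm]
    exact_mod_cast h5
  have hbase : 0 ≤ ((N + M : ℕ) : ℝ) - (n + k : ℕ) * (1 - 1 / a) := by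
    have h3 : ((n + k : ℕ) : ℝ) ≤ (N + M : ℕ) := by exact_mod_cast (by omega : n + k ≤ N + M)
    nlinarith [(Nat.cast_nonneg (n + k) : (0 : ℝ) ≤ (n + k : ℕ))]
  have hbase2 : ((N + M : ℕ) : ℝ) - (n + k : ℕ) * (1 - 1 / a) ≤
      M * ((N : ℝ) / M + (1 - η * (1 - 1 / a))) := by
    have h3 : η * M ≤ (n + k : ℕ) := by
      have : (1 : ℝ) ≤ n := by exact_mod_cast hn
      push_cast; linarith
    have h4 := mul_le_mul_of_nonneg_right h3 ha1
    have h5 : (M : ℝ) * (N / M) = N := by field_simp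
    rw [mul_add, h5]
    push_cast at *
    nlinarith
  rcases le_or_gt (1 - 1 / ((M : ℝ) * ε ^ 2)) 0 with hneg | hpos
  · refine (mul_nonpos_of_nonpos_of_nonneg hneg measureReal_nonneg).trans ?_
    have h3 : 0 ≤ (N : ℝ) / M + (1 - η * (1 - 1 / a)) := by
      have : 0 ≤ (N : ℝ) / M := by positivity
      nlinarith [hη.1, hη.2]
    positivity
  · have hp0 : 0 ≤ p := measureReal_nonneg
    have hq : 0 ≤ (1 - 1 / ((M : ℝ) * ε ^ 2)) * p := mul_nonneg hpos.le hp0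
    have h3 : (M : ℝ) ^ N * ((1 - 1 / ((M : ℝ) * ε ^ 2)) * p) ≤
        M ^ N * (a ^ (n - 1) * ((N : ℝ) / M + (1 - η * (1 - 1 / a))) ^ N) := by
      calc _ ≤ ((N + M).choose N * N.factorial : ℝ) * ((1 - 1 / ((M : ℝ) * ε ^ 2)) * p) := by
            gcongr
        _ = (N + M).choose N * ((1 - 1 / ((M : ℝ) * ε ^ 2)) * p) * N.factorial := by ring
        _ ≤ a ^ (n - 1) * (((N + M : ℕ) : ℝ) - (n + k : ℕ) * (1 - 1 / a)) ^ N := h1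
        _ ≤ a ^ (n - 1) * (M * ((N : ℝ) / M + (1 - η * (1 - 1 / a)))) ^ N := by gcongr
        _ = _ := by rw [mul_pow]; ring
    exact le_of_mul_le_mul_left h3 (by positivity)

/-- Chernoff-type tail bound for the violation probability of `N` samples; its right-hand side
bounds the probability of at most `n - 1` successes in `N` trials of success probability `η`. -/
theorem measure_violation_gt_le {n : ℕ}
    (hV : ∀ (ι : Type) (S : Finset ι), S.Nonempty → Measurable fun ω : ι → W => V (S.image ω))
    {N : ℕ} (hn : 1 ≤ n) (hN : n ≤ N) {a : ℝ} (ha : 1 ≤ a)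
    (hcount : ∀ (ι : Type) [Fintype ι] [DecidableEq ι] (ω : ι → W) (k : ℕ),
      n + k ≤ Fintype.card ι → (#{S ∈ powersetCard N (univ : Finset ι) |
        k < #{x ∈ Sᶜ | V (S.image ω) < V ((insert x S).image ω)}} : ℝ) * N.factorial ≤
          a ^ (n - 1) * (Fintype.card ι - (n + k : ℕ) * (1 - 1 / a)) ^ N)
    {η : ℝ} (hη : η ∈ Ioo (0 : ℝ) 1) :
    (Measure.pi fun _ : Fin N => μ) {ω | η < μ.real (violatedBy V (Finset.univ.image ω))} ≤
      ENNReal.ofReal (a ^ (n - 1) * (1 - η * (1 - 1 / a)) ^ N) := by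
  have hU : {ω : Fin N → W | η < μ.real (violatedBy V (Finset.univ.image ω))} =
      ⋃ j : ℕ, {ω | η + 1 / ((j : ℝ) + 1) ≤ μ.real (violatedBy V (Finset.univ.image ω))} := by
    ext ω
    simp only [Set.mem_ofPred_eq, Set.mem_iUnion]
    constructor
    · intro h
      obtain ⟨j, hj⟩ := exists_nat_one_div_lt (sub_pos.2 h)
      exact ⟨j, by linarith⟩
    · rintro ⟨j, hj⟩
      have : 0 < 1 / ((j : ℝ) + 1) := by positivity
      linarith
  rw [hU, Monotone.measure_iUnion]
  · refine iSup_le fun j => ?_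
    rw [← ENNReal.ofReal_toReal (measure_ne_top _ _)]
    exact ENNReal.ofReal_le_ofReal
      (measureReal_violation_ge_le μ hV hn hN ha hcount hη (by positivity))
  · intro i j hij ω hω
    simp only [Set.mem_ofPred_eq] at hω ⊢
    have : 1 / ((j : ℝ) + 1) ≤ 1 / ((i : ℝ) + 1) := by gcongr
    linarith

end Limit

/-! ### The sample sizes -/

section SampleSize

open Filter Topology

/-- The explicit sample size comes from `a = 1 + s + s ^ 2 / 2` with `s = √(2 L / d)`, since then
`log a ≤ s`. -/
lemma log_bound_le {L d : ℝ} (hL : 0 < L) (hd : 0 < d) :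
    ∃ a : ℝ, 1 < a ∧ a / (a - 1) * (L + d * Real.log a) ≤ L + d + Real.sqrt (2 * d * L) := by
  set s := Real.sqrt (2 * L / d) with hs
  have hs2 : s ^ 2 = 2 * L / d := Real.sq_sqrt (by positivity)
  have hs0 : 0 < s := Real.sqrt_pos.2 (by positivity)
  have hL' : L = d * (s ^ 2 / 2) := by rw [hs2]; field_simp
  have hsq : Real.sqrt (2 * d * L) = d * s := by
    rw [show 2 * d * L = (d * s) ^ 2 by rw [mul_pow, hs2]; field_simp]
    exact Real.sqrt_sq (by positivity)
  have hexp := Real.quadratic_le_exp_of_nonneg hs0.le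
  have ha0 : 0 < 1 + s + s ^ 2 / 2 := by positivity
  have hlog : Real.log (1 + s + s ^ 2 / 2) ≤ s :=
    (Real.log_le_log ha0 hexp).trans_eq (Real.log_exp s)
  refine ⟨1 + s + s ^ 2 / 2, by nlinarith, ?_⟩
  have hpos : 0 < 1 + s + s ^ 2 / 2 - 1 := by nlinarith
  rw [hsq, div_mul_eq_mul_div, div_le_iff₀ hpos, hL']
  have : d * Real.log (1 + s + s ^ 2 / 2) ≤ d * s := by gcongr
  calc _ ≤ (1 + s + s ^ 2 / 2) * (d * (s ^ 2 / 2) + d * s) := by gcongr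
    _ = _ := by ring

/-- Either sample size condition provides a suitable `a` up to an arbitrarily small error; for
`d = 0` the infimum is approached as `a → ∞` and not attained. -/
lemma exists_le_add_of_iInf_or {η L d x : ℝ} (hη : 0 < η) (hL : 0 < L) (hd : 0 ≤ d)
    (h : (⨅ a : Ioi (1 : ℝ), 1 / η * ((a : ℝ) / ((a : ℝ) - 1)) * (L + d * Real.log (a : ℝ))) ≤ x ∨
      1 / η * (L + d + Real.sqrt (2 * d * L)) ≤ x) {ε : ℝ} (hε : 0 < ε) :
    ∃ a : ℝ, 1 < a ∧ a / (a - 1) * (L + d * Real.log a) ≤ η * (x + ε) := by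
  rcases h with h | h
  · have : Nonempty (Ioi (1 : ℝ)) := ⟨⟨2, by norm_num⟩⟩
    obtain ⟨⟨a, ha⟩, hlt⟩ := exists_lt_of_ciInf_lt (lt_of_le_of_lt h (lt_add_of_pos_right x hε))
    refine ⟨a, ha, ?_⟩
    simp only at hlt
    rw [mul_assoc, one_div, inv_mul_lt_iff₀ hη] at hlt
    exact hlt.le
  · rw [one_div, inv_mul_le_iff₀ hη] at h
    have hlt : η * x < η * (x + ε) := by gcongr; linarith
    rcases hd.eq_or_lt with rfl | hd
    · simp only [mul_zero, zero_mul, Real.sqrt_zero, add_zero] at h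
      have ht : Tendsto (fun a : ℝ => a / (a - 1) * (L + 0 * Real.log a)) atTop (𝓝 (1 * L)) := by
        simp only [zero_mul, add_zero]
        refine Tendsto.mul_const L ?_
        have h1 : Tendsto (fun a : ℝ => 1 + 1 / (a - 1)) atTop (𝓝 (1 + 0)) :=
          tendsto_const_nhds.add (tendsto_const_nhds.div_atTop
            (tendsto_atTop_add_const_right _ _ tendsto_id))
        rw [add_zero] at h1
        refine h1.congr' ?_
        filter_upwards [eventually_gt_atTop 1] with a ha
        have : a - 1 ≠ 0 := by linarith
        field_simp
        ring
      rw [one_mul] at ht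
      obtain ⟨a, ha, ha1⟩ := ((ht.eventually (gt_mem_nhds (h.trans_lt hlt))).and
        (eventually_gt_atTop 1)).exists
      exact ⟨a, ha1, ha.le⟩
    · obtain ⟨a, ha, hle⟩ := log_bound_le hL hd
      exact ⟨a, ha, hle.trans (h.trans hlt.le)⟩

lemma tail_bound_le {η δ : ℝ} (hη : η ∈ Ioo (0 : ℝ) 1) (hδ : 0 < δ) {n N : ℕ} (hn : 1 ≤ n)
    {a ε : ℝ} (ha : 1 < a) (hε : 0 ≤ ε)
    (h : a / (a - 1) * (Real.log (1 / δ) + ((n : ℝ) - 1) * Real.log a) ≤ η * (N + ε)) :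
    a ^ (n - 1) * (1 - η * (1 - 1 / a)) ^ N ≤ δ * Real.exp (η * ε) := by
  have ha0 : 0 < a := by linarith
  have ha1 : 0 < a - 1 := by linarith
  have hb : 1 - 1 / a = (a - 1) / a := by field_simp
  have hb1 : (a - 1) / a ≤ 1 := by rw [div_le_one ha0]; linarith
  rw [div_mul_eq_mul_div, div_le_iff₀ ha1] at h
  have h1 : Real.log (1 / δ) + ((n : ℝ) - 1) * Real.log a ≤ η * (N + ε) * ((a - 1) / a) := by
    rw [← mul_div_assoc, le_div_iff₀ ha0]; linarith
  have h2 : η * (N + ε) * ((a - 1) / a) ≤ η * N * ((a - 1) / a) + η * ε := by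
    have := mul_le_mul_of_nonneg_left hb1 (mul_nonneg hη.1.le hε)
    nlinarith
  have h3 : 0 ≤ 1 - η * ((a - 1) / a) := by
    have : 0 ≤ (a - 1) / a := by positivity
    nlinarith [hη.1, hη.2]
  have h4 : 1 - η * ((a - 1) / a) ≤ Real.exp (-(η * ((a - 1) / a))) := by
    have := Real.add_one_le_exp (-(η * ((a - 1) / a)))
    linarith
  have h5 : a ^ (n - 1) = Real.exp (((n : ℝ) - 1) * Real.log a) := by
    have : (n : ℝ) - 1 = ((n - 1 : ℕ) : ℝ) := by rw [Nat.cast_sub hn, Nat.cast_one]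
    rw [this, Real.exp_nat_mul, Real.exp_log ha0]
  have h6 : δ = Real.exp (-Real.log (1 / δ)) := by
    rw [one_div, Real.log_inv, neg_neg, Real.exp_log hδ]
  rw [hb]
  calc _ ≤ a ^ (n - 1) * Real.exp (-(η * ((a - 1) / a))) ^ N := by gcongr
    _ = Real.exp (((n : ℝ) - 1) * Real.log a + N * (-(η * ((a - 1) / a)))) := by
        rw [h5, ← Real.exp_nat_mul, ← Real.exp_add]
    _ ≤ Real.exp (-Real.log (1 / δ) + η * ε) := by
        apply Real.exp_le_exp.2; linarith
    _ = _ := by rw [Real.exp_add, ← h6]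

end SampleSize

/-! ### Scenario programs -/

section ScenarioProgram

open Finset Filter Topology

variable {n : ℕ} {W : Type*}

/-- The designs in `Θ` that meet the specification for the uncertainty `w`. -/
def constraintSet (Θ : Set (Fin n → ℝ)) (f : (Fin n → ℝ) → W → EReal) (w : W) :
    Set (Fin n → ℝ) :=
  {θ | θ ∈ Θ ∧ f θ w ≤ 0}

/-- The objective `θ ↦ cᵀ θ` as a linear map. -/
def linearCost (c : Fin n → ℝ) : (Fin n → ℝ) →ₗ[ℝ] ℝ where
  toFun θ := c ⬝ᵥ θ
  map_add' := dotProduct_add c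
  map_smul' r θ := dotProduct_smul r c θ

variable {Θ : Set (Fin n → ℝ)} {c : Fin n → ℝ} {f : (Fin n → ℝ) → W → EReal}

lemma constraintFn_eq_zero_iff {θ : Fin n → ℝ} {w : W} : constraintFn f θ w = 0 ↔ f θ w ≤ 0 := by
  simp [constraintFn]

lemma constraintFn_eq_one_iff {θ : Fin n → ℝ} {w : W} : constraintFn f θ w = 1 ↔ ¬ f θ w ≤ 0 := by
  simp [constraintFn]

lemma convex_constraintSet (h : ConvexityAssumption Θ f) (w : W) :
    Convex ℝ (constraintSet Θ f w) := by
  intro x hx y hy s t hs ht hst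
  have h1 := h.2.2 w (x := (x, 0)) (y := (y, 0)) hx hy hs ht hst
  simpa [constraintSet] using h1

lemma feasibleSet_eq [DecidableEq W] {N : ℕ} (hN : 0 < N) (ω : Fin N → W) :
    feasibleSet Θ f ω = ⋂ w ∈ Finset.univ.image ω, constraintSet Θ f w := by
  ext θ
  simp only [feasibleSet, constraintFn_eq_zero_iff, constraintSet, Set.mem_ofPred_eq,
    Set.mem_iInter, Finset.mem_image, Finset.mem_univ, true_and, forall_exists_index,
    forall_apply_eq_imp_iff]
  exact ⟨fun h l => ⟨h.1, h.2 l⟩, fun h => ⟨(h ⟨0, hN⟩).1, fun l => (h l).2⟩⟩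

lemma isScenarioSolution_iff [DecidableEq W] {N : ℕ} (hN : 0 < N) (ω : Fin N → W)
    (θ : Fin n → ℝ) :
    IsScenarioSolution Θ c f ω θ ↔
      IsOptimalFor (constraintSet Θ f) (linearCost c) (Finset.univ.image ω) θ := by
  unfold IsScenarioSolution IsOptimalFor
  rw [feasibleSet_eq hN]
  rfl

lemma exists_image_eq [DecidableEq W] {M : ℕ} {S : Finset W} (hS : S.Nonempty) (hM : #S ≤ M) :
    ∃ ω : Fin M → W, Finset.univ.image ω = S := by
  obtain ⟨w₀, hw₀⟩ := hS
  refine ⟨fun i => if h : (i : ℕ) < #S then S.equivFin.symm ⟨i, h⟩ else w₀, ?_⟩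
  ext w
  simp only [Finset.mem_image, Finset.mem_univ, true_and]
  constructor
  · rintro ⟨i, rfl⟩
    split_ifs
    · exact Subtype.prop _
    · exact hw₀
  · intro hw
    refine ⟨⟨S.equivFin ⟨w, hw⟩, by omega⟩, ?_⟩
    simp

/-- The assumption on multisamples of one size `M ≥ n + 1` extends to all finite sets of
uncertainties. -/
lemma FeasibilityUniquenessAssumption.of_finset {M : ℕ}
    (h : FeasibilityUniquenessAssumption Θ c f M) (hn : 1 ≤ n) (hM : n + 1 ≤ M)
    (hconv : ConvexityAssumption Θ f) {S : Finset W} (hS : S.Nonempty) :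
    (interior (⋂ w ∈ S, constraintSet Θ f w)).Nonempty ∧
      ∃! θ, IsOptimalFor (constraintSet Θ f) (linearCost c) S θ := by
  classical
  refine interior_nonempty_and_existsUnique_isOptimalFor (convex_constraintSet hconv)
    (by simpa using hn) (fun S hS hSc => ?_) hS
  rw [Module.finrank_fin_fun] at hSc
  obtain ⟨ω, rfl⟩ := exists_image_eq hS (hSc.trans hM)
  have h1 := h ω
  simp only [isScenarioSolution_iff (by omega : 0 < M), feasibleSet_eq (by omega : 0 < M)] at h1
  exact h1

/-- The optimal value is a measurable function of the samples, although the optimal solution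
need not be: as the feasible set is convex with nonempty interior, the infimum can be computed over
a countable dense set of designs. -/
lemma measurable_value_image [MeasurableSpace W] [DecidableEq W]
    (hf : Measurable fun p : Θ × W => f p.1 p.2) (hconv : ConvexityAssumption Θ f)
    (hint : ∀ S : Finset W, S.Nonempty → (interior (⋂ w ∈ S, constraintSet Θ f w)).Nonempty)
    {θ : Finset W → Fin n → ℝ}
    (hθ : ∀ S : Finset W, S.Nonempty → IsOptimalFor (constraintSet Θ f) (linearCost c) S (θ S))
    {ι : Type*} {S : Finset ι} (hS : S.Nonempty) :
    Measurable fun ω : ι → W => c ⬝ᵥ θ (S.image ω) := by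
  refine measurable_of_Iio fun t => ?_
  let q := TopologicalSpace.denseSeq (Fin n → ℝ)
  have hset : (fun ω : ι → W => c ⬝ᵥ θ (S.image ω)) ⁻¹' Iio t =
      ⋃ j, {ω | (q j ∈ Θ ∧ c ⬝ᵥ q j < t) ∧ ∀ i ∈ S, f (q j) (ω i) ≤ 0} := by
    ext ω
    simp only [Set.mem_preimage, Set.mem_Iio, Set.mem_iUnion, Set.mem_ofPred_eq]
    have hopt := hθ (S.image ω) (hS.image ω)
    constructor
    · intro hlt
      have hK : Convex ℝ (⋂ w ∈ S.image ω, constraintSet Θ f w) :=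
        convex_iInter₂ fun w _ => convex_constraintSet hconv w
      have hcl : θ (S.image ω) ∈ closure (interior (⋂ w ∈ S.image ω, constraintSet Θ f w)) := by
        rw [hK.closure_interior_eq_closure_of_nonempty_interior (hint _ (hS.image ω))]
        exact subset_closure hopt.1
      have hopen : IsOpen {y : Fin n → ℝ | c ⬝ᵥ y < t} :=
        isOpen_lt (by unfold dotProduct; fun_prop) continuous_const
      have hne := mem_closure_iff.1 hcl _ hopen hlt
      obtain ⟨y, hy, j, rfl⟩ :=
        (TopologicalSpace.denseRange_denseSeq (Fin n → ℝ)).inter_open_nonempty _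
          (hopen.inter isOpen_interior) hne
      have hyK := Set.mem_iInter₂.1 (interior_subset hy.2)
      obtain ⟨i₀, hi₀⟩ := hS
      exact ⟨j, ⟨(hyK _ (Finset.mem_image_of_mem ω hi₀)).1, hy.1⟩,
        fun i hi => (hyK _ (Finset.mem_image_of_mem ω hi)).2⟩
    · rintro ⟨j, ⟨hj, hjt⟩, hjf⟩
      refine lt_of_le_of_lt (hopt.2 (q j) (Set.mem_iInter₂.2 fun w hw => ?_)) hjt
      obtain ⟨i, hi, rfl⟩ := Finset.mem_image.1 hw
      exact ⟨hj, hjf i hi⟩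
  rw [hset]
  refine MeasurableSet.iUnion fun j => ?_
  by_cases hj : q j ∈ Θ ∧ c ⬝ᵥ q j < t
  · simp only [hj, and_self, true_and]
    have h1 : Measurable fun w => f (q j) w :=
      hf.comp (measurable_const.prodMk measurable_id :
        Measurable fun w : W => ((⟨q j, hj.1⟩ : Θ), w))
    have h2 : {ω : ι → W | ∀ i ∈ S, f (q j) (ω i) ≤ 0} = ⋂ i ∈ S, {ω | f (q j) (ω i) ≤ 0} := by
      ext ω; simp
    rw [h2]
    exact S.measurableSet_biInter fun i _ =>
      measurableSet_le (h1.comp (measurable_pi_apply i)) measurable_const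
  · simp [hj]

/-- By uniqueness of optimal solutions, a constraint violated by the optimal solution raises the
optimal value. -/
lemma violation_subset_violatedBy [DecidableEq W] {θ : Finset W → Fin n → ℝ}
    (hθ : ∀ S : Finset W, S.Nonempty → IsOptimalFor (constraintSet Θ f) (linearCost c) S (θ S) ∧
      ∀ u, IsOptimalFor (constraintSet Θ f) (linearCost c) S u → u = θ S)
    {S : Finset W} (hS : S.Nonempty) :
    {w | constraintFn f (θ S) w = 1} ⊆ violatedBy (fun S => c ⬝ᵥ θ S) S := by
  intro w hw
  rw [Set.mem_ofPred_eq, constraintFn_eq_one_iff] at hw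
  by_contra hcon
  have hle : c ⬝ᵥ θ (insert w S) ≤ c ⬝ᵥ θ S := not_lt.1 hcon
  have hmem := (hθ (insert w S) (insert_nonempty w S)).1.1
  have hopt : IsOptimalFor (constraintSet Θ f) (linearCost c) S (θ (insert w S)) :=
    ⟨Set.biInter_subset_biInter_left (Finset.subset_insert w S) hmem,
      fun θ' hθ' => hle.trans ((hθ S hS).1.2 θ' hθ')⟩
  have h1 := Set.mem_iInter₂.1 hmem w (Finset.mem_insert_self w S)
  rw [(hθ S hS).2 _ hopt] at h1
  exact hw h1.2

/-- The set of bad multisamples need not be measurable; it is contained in the measurable set where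
the probability of raising the optimal value exceeds `η`, which bounds its outer measure. -/
theorem measure_violationProb_gt_le [MeasurableSpace W] (μ : Measure W) [IsProbabilityMeasure μ]
    (hf : Measurable fun p : Θ × W => f p.1 p.2) (hconv : ConvexityAssumption Θ f)
    (hn : 1 ≤ n) {M : ℕ} (hM : n + 1 ≤ M) (hfeas : FeasibilityUniquenessAssumption Θ c f M)
    {N : ℕ} (hN : n ≤ N) {a η : ℝ} (ha : 1 ≤ a) (hη : η ∈ Ioo (0 : ℝ) 1) :
    Measure.pi (fun _ : Fin N => μ)
        {ω | ¬ ∃ θ, IsScenarioSolution Θ c f ω θ ∧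
          (∀ θ', IsScenarioSolution Θ c f ω θ' → θ' = θ) ∧ violationProb μ f θ ≤ η} ≤
      ENNReal.ofReal (a ^ (n - 1) * (1 - η * (1 - 1 / a)) ^ N) := by
  classical
  have hall := fun (S : Finset W) (hS : S.Nonempty) => hfeas.of_finset hn hM hconv hS
  have hex : ∀ S : Finset W, ∃ θ, S.Nonempty →
      IsOptimalFor (constraintSet Θ f) (linearCost c) S θ ∧
        ∀ u, IsOptimalFor (constraintSet Θ f) (linearCost c) S u → u = θ := fun S => by
    by_cases hS : S.Nonempty
    · obtain ⟨θ, h1, h2⟩ := (hall S hS).2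
      exact ⟨θ, fun _ => ⟨h1, h2⟩⟩
    · exact ⟨0, fun h => absurd h hS⟩
  choose θ hθ using hex
  have hcount : ∀ (ι : Type) [Fintype ι] [DecidableEq ι] (ω : ι → W) (k : ℕ),
      n + k ≤ Fintype.card ι → (#{S ∈ powersetCard N (Finset.univ : Finset ι) |
        k < #{x ∈ Sᶜ | c ⬝ᵥ θ (S.image ω) < c ⬝ᵥ θ ((insert x S).image ω)}} : ℝ) *
        N.factorial ≤ a ^ (n - 1) * (Fintype.card ι - (n + k : ℕ) * (1 - 1 / a)) ^ N := by
    intro ι _ _ ω k hk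
    have himg : ∀ S : Finset ι, ⋂ i ∈ S, constraintSet Θ f (ω i) =
        ⋂ w ∈ S.image ω, constraintSet Θ f w := fun S => by
      ext; simp
    have hne : (Finset.univ : Finset ι).Nonempty := by
      rw [← card_pos, card_univ]; omega
    refine card_many_violators_convex_le (C := fun i => constraintSet Θ f (ω i))
      (fun i => convex_constraintSet hconv _) ?_ c (V := fun S => c ⬝ᵥ θ (S.image ω)) ?_ hn hN hk ha
    · have h1 := (hall _ (hne.image ω)).1
      rw [← himg] at h1
      simpa using h1
    · intro S hS
      have h1 := (hθ _ (hS.image ω)).1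
      rw [himg]
      refine ⟨⟨_, h1.1, rfl⟩, ?_⟩
      rintro _ ⟨θ', hθ', rfl⟩
      exact h1.2 θ' hθ'
  have hN0 : 0 < N := by omega
  refine (measure_mono ?_).trans (measure_violation_gt_le μ (V := fun S => c ⬝ᵥ θ S)
    (fun ι S hS => measurable_value_image hf hconv (fun S hS => (hall S hS).1)
      (fun S hS => (hθ S hS).1) hS) hn hN ha hcount hη)
  intro ω hω
  have hne : (Finset.univ.image ω).Nonempty :=
    ⟨ω ⟨0, hN0⟩, Finset.mem_image_of_mem ω (Finset.mem_univ _)⟩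
  by_contra hcon
  refine hω ⟨θ (Finset.univ.image ω), (isScenarioSolution_iff hN0 ω _).2 (hθ _ hne).1,
    fun θ' h => (hθ _ hne).2 θ' ((isScenarioSolution_iff hN0 ω _).1 h), ?_⟩
  exact (measureReal_mono (violation_subset_violatedBy hθ hne)).trans (not_lt.1 hcon)

end ScenarioProgram

theorem theorem4 {W : Type*} [MeasurableSpace W] (μ : Measure W) [IsProbabilityMeasure μ]
    (n : ℕ) (hn : 1 ≤ n) (N : ℕ)
    (Θ : Set (Fin n → ℝ)) (c : Fin n → ℝ) (f : (Fin n → ℝ) → W → EReal)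
    (hf : Measurable (fun p : Θ × W => f p.1 p.2))
    (hconv : ConvexityAssumption Θ f)
    -- The thresholds below force `n ≤ N`; for `n < N` the size `max N (n + 1)` is just `N`.
    (hfeas : FeasibilityUniquenessAssumption Θ c f (max N (n + 1)))
    (η δ : ℝ) (hη : η ∈ Ioo (0 : ℝ) 1) (hδ : δ ∈ Ioo (0 : ℝ) 1)
    (hN : (⨅ a : Ioi (1 : ℝ), 1 / η * ((a : ℝ) / ((a : ℝ) - 1)) *
              (Real.log (1 / δ) + ((n : ℝ) - 1) * Real.log (a : ℝ))) ≤ (N : ℝ) ∨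
          1 / η * (Real.log (1 / δ) + ((n : ℝ) - 1) +
              Real.sqrt (2 * ((n : ℝ) - 1) * Real.log (1 / δ))) ≤ (N : ℝ)) :
    -- With probability at least `1 - δ`, the optimal solution has violation probability `≤ η`.
    ∃ A : Set (Fin N → W), MeasurableSet A ∧
      ENNReal.ofReal (1 - δ) ≤ Measure.pi (fun _ : Fin N => μ) A ∧
      ∀ ω ∈ A, ∃ θ, IsScenarioSolution Θ c f ω θ ∧
        (∀ θ', IsScenarioSolution Θ c f ω θ' → θ' = θ) ∧ violationProb μ f θ ≤ η := by
  have hL : 0 < Real.log (1 / δ) := Real.log_pos (by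
    rw [lt_div_iff₀ hδ.1, one_mul]; exact hδ.2)
  have hd : (0 : ℝ) ≤ (n : ℝ) - 1 := by
    have : (1 : ℝ) ≤ n := by exact_mod_cast hn
    linarith
  have htail : ∀ ε : ℝ, 0 < ε → ∃ a : ℝ, 1 < a ∧
      a ^ (n - 1) * (1 - η * (1 - 1 / a)) ^ N ≤ δ * Real.exp (η * ε) := fun ε hε => by
    obtain ⟨a, ha, hle⟩ := exists_le_add_of_iInf_or hη.1 hL hd hN hε
    exact ⟨a, ha, tail_bound_le hη hδ.1 hn ha hε.le hle⟩
  have hlim : Filter.Tendsto (fun ε : ℝ => δ * Real.exp (η * ε)) (nhdsWithin 0 (Ioi 0))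
      (nhds δ) := by
    have hcont : Continuous fun ε : ℝ => δ * Real.exp (η * ε) := by fun_prop
    simpa using (hcont.tendsto 0).mono_left (nhdsWithin_le_nhds (s := Ioi 0))
  -- For `N < n` the tail bound would be at least `1`, but it is at most `δ` up to a factor
  -- near `1`.
  have hnN : n ≤ N := by
    by_contra hlt
    obtain ⟨ε, hε1, hε⟩ := ((hlim.eventually (gt_mem_nhds hδ.2)).and self_mem_nhdsWithin).exists
    obtain ⟨a, ha, hle⟩ := htail ε hε
    have ha0 : 0 < a := by linarith
    have h1 : 1 / a ≤ 1 - η * (1 - 1 / a) := by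
      have : 1 / a ≤ 1 := by rw [div_le_one ha0]; exact ha.le
      nlinarith [hη.2]
    have h2 : (1 : ℝ) ≤ a ^ (n - 1) * (1 - η * (1 - 1 / a)) ^ N := by
      calc (1 : ℝ) = a ^ N * (1 / a) ^ N := by
            rw [← mul_pow, mul_one_div_cancel ha0.ne', one_pow]
        _ ≤ _ := by
            gcongr
            · exact ha.le
            · omega
    linarith
  set P := Measure.pi fun _ : Fin N => μ
  set B : Set (Fin N → W) := {ω | ¬ ∃ θ, IsScenarioSolution Θ c f ω θ ∧
    (∀ θ', IsScenarioSolution Θ c f ω θ' → θ' = θ) ∧ violationProb μ f θ ≤ η}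
  have hB : P B ≤ ENNReal.ofReal δ := by
    refine ge_of_tendsto ((ENNReal.continuous_ofReal.tendsto δ).comp hlim) ?_
    filter_upwards [self_mem_nhdsWithin] with ε hε
    obtain ⟨a, ha, hle⟩ := htail ε hε
    exact (measure_violationProb_gt_le μ hf hconv hn (le_max_right N (n + 1)) hfeas hnN ha.le
      hη).trans (ENNReal.ofReal_le_ofReal hle)
  -- The bad set `B` is enclosed in a measurable set of the same outer measure.
  refine ⟨(toMeasurable P B)ᶜ, (measurableSet_toMeasurable P B).compl, ?_, fun ω hω => ?_⟩
  · rw [prob_compl_eq_one_sub (measurableSet_toMeasurable P B), measure_toMeasurable,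
      ENNReal.ofReal_sub _ hδ.1.le, ENNReal.ofReal_one]
    exact tsub_le_tsub_left hB 1
  · by_contra hcon
    exact hω (subset_toMeasurable P B hcon)
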